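/- Let $\mathcal X,\mathcal Y$ be finite alphabets and let $(X,Y)=\{(X_n,Y_n):n\in\mathbb Z\}$ be a jointly stationary and ergodic $\mathcal X\times\mathcal Y$-valued process. Write $z_i^j=(z_i,\dots,z_j)$, let $\log=\log_2$, and let $P(x_1^n|y_1^n)=\mathbb P(X_1^n=x_1^n\mid Y_1^n=y_1^n)$. For a realization $(x,y)$ and $n\ge 1$ put $$\mathcal R_n^{(1)}(y)=\inf\{i\ge1: y_{-i+1}^{-i+n}=y_1^n\},\qquad \mathcal R_n^{(j)}(y)=\inf\{i>\mathcal R_n^{(j-1)}(y): y_{-i+1}^{-i+n}=y_1^n\}\quad (j>1),$$ and define the conditional recurrence time $$\mathcal R_n(x|y)=\inf\Big\{i\ge1:\ \mathcal R_n^{(i)}(y)<\infty,\ x_{-\mathcal R_n^{(i)}(y)+1}^{-\mathcal R_n^{(i)}(y)+n}=x_1^n\Big\},$$ where $\inf\emptyset=\infty$. For a stationary process $Z=\{Z_n:n\in\mathbb Z\}$ with values in a finite set $\mathcal Z$, and $d\ge1$, let $$\gamma^{(Z)}(d)=\max_{z\in\mathcal Z}\mathbb E\Big|\log\mathbb P(Z_0=z\mid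 Z_{-\infty}^{-1})-\log\mathbb P(Z_0=z\mid Z_{-d}^{-1})\Big|\in[0,\infty],$$ with $\log 0=-\infty$ and with the difference read as $0$ where both conditional probabilities vanish. Let $H(X|Y)=\limsup_{n\to\infty}\frac1nH(X_1^n|Y_1^n)$ be the conditional entropy rate in bits. Then, almost surely, $1\le\mathcal R_n(X|Y)<\infty$ and $P(X_1^n|Y_1^n)>0$ for all $n$, and: (a) If $\sum_{d\ge1}\gamma^{(X,Y)}(d)<\infty$ and $\sum_{d\ge1}\gamma^{(Y)}(d)<\infty$, then for every $\beta>0$, $$\log\big[\mathcal R_n(X|Y)\,P(X_1^n|Y_1^n)\big]=o(n^\beta)\quad\text{a.s.}$$ (b) Without these summability assumptions, $$\log\big[\mathcal R_n(X|Y)\,P(X_1^n|Y_1^n)\big]=o(n)\quad\text{a.s.},$$ and hence $$\lim_{n\to\infty}\frac1n\log\mathcal R_n(X|Y)=H(X|Y)\quad\text{a.s.}$$ -/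

import Mathlib

open MeasureTheory ProbabilityTheory Filter Topology Asymptotics
open scoped ENNReal

namespace SideInfo

/-! ### Strings and recurrence times of two-sided sequences -/

/-- The string `x_{m+1}^{m+n} = (x_{m+1}, …, x_{m+n})` of a two-sided sequence. -/
def block {A : Type*} (x : ℤ → A) (m : ℤ) (n : ℕ) : Fin n → A :=
  fun k => x (m + 1 + (k : ℤ))

/-- The repeated recurrence times `R_n^{(j)}(x)` of `x_1^n`, with values in `ℕ ∪ {∞}`
(the infimum of the empty set is `∞`). Setting `R_n^{(0)} = 0` makes the first case,
`R_n^{(1)} = inf {i ≥ 1 : x_{-i+1}^{-i+n} = x_1^n}`, an instance of the recursion. -/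
noncomputable def recTime {A : Type*} (x : ℤ → A) (n : ℕ) : ℕ → ℕ∞
  | 0 => 0
  | j + 1 => ⨅ i ∈ {i : ℕ | recTime x n j < (i : ℕ∞) ∧ block x (-(i : ℤ)) n = block x 0 n},
      (i : ℕ∞)

/-- The conditional recurrence time `R_n(x|y)` of `x_1^n` among the appearances of `y_1^n`:
the least `i ≥ 1` such that the `i`-th recurrence time `r` of `y_1^n` is finite and
`x_{-r+1}^{-r+n} = x_1^n`. -/
noncomputable def condRecTime {A B : Type*} (x : ℤ → A) (y : ℤ → B) (n : ℕ) : ℕ∞ :=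
  ⨅ i ∈ {i : ℕ | 1 ≤ i ∧ ∃ r : ℕ, recTime y n i = (r : ℕ∞) ∧
      block x (-(r : ℤ)) n = block x 0 n}, (i : ℕ∞)

/-! ### Processes -/

/-- The sample path of a process at the outcome `ω`. -/
def path {Ω A : Type*} (Z : ℤ → Ω → A) (ω : Ω) : ℤ → A := fun k => Z k ω

/-- The joint process `(X, Y)`. -/
def pair {Ω A B : Type*} (X : ℤ → Ω → A) (Y : ℤ → Ω → B) : ℤ → Ω → A × B :=
  fun k ω => (X k ω, Y k ω)

/-- The left shift on two-sided sequences. -/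
def shift {A : Type*} (x : ℤ → A) : ℤ → A := fun k => x (k + 1)

/-- A process is stationary and ergodic if the shift preserves its law on path space and is
ergodic for it. (Mathlib's `Ergodic` includes measure preservation.) -/
def IsStationaryErgodic {Ω A : Type*} [MeasurableSpace Ω] [MeasurableSpace A]
    (μ : Measure Ω) (Z : ℤ → Ω → A) : Prop :=
  Ergodic (shift : (ℤ → A) → (ℤ → A)) (μ.map (path Z))

/-! ### Conditional probabilities of strings and conditional entropy rate (in bits) -/

/-- The conditional probability mass function
`P(x_1^n | y_1^n) = ℙ(X_1^n = x_1^n, Y_1^n = y_1^n) / ℙ(Y_1^n = y_1^n)`. -/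
noncomputable def condPMF {Ω A B : Type*} [MeasurableSpace Ω] (μ : Measure Ω)
    (X : ℤ → Ω → A) (Y : ℤ → Ω → B) (n : ℕ) (x : Fin n → A) (y : Fin n → B) : ℝ :=
  μ.real {ω | block (path X ω) 0 n = x ∧ block (path Y ω) 0 n = y} /
    μ.real {ω | block (path Y ω) 0 n = y}

/-- The random variable `P(X_1^n | Y_1^n)`. -/
noncomputable def condProbRV {Ω A B : Type*} [MeasurableSpace Ω] (μ : Measure Ω)
    (X : ℤ → Ω → A) (Y : ℤ → Ω → B) (n : ℕ) (ω : Ω) : ℝ :=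
  condPMF μ X Y n (block (path X ω) 0 n) (block (path Y ω) 0 n)

/-- The conditional entropy
`H(X_1^n | Y_1^n) = - ∑_{x, y} ℙ(X_1^n = x, Y_1^n = y) log₂ P(x | y)`, in bits. -/
noncomputable def condEntropy {Ω A B : Type*} [MeasurableSpace Ω] [Fintype A] [Fintype B]
    (μ : Measure Ω) (X : ℤ → Ω → A) (Y : ℤ → Ω → B) (n : ℕ) : ℝ :=
  -∑ x : Fin n → A, ∑ y : Fin n → B,
    μ.real {ω | block (path X ω) 0 n = x ∧ block (path Y ω) 0 n = y} *
      Real.logb 2 (condPMF μ X Y n x y)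

/-- The conditional entropy rate `H(X|Y) = limsup_n (1/n) H(X_1^n | Y_1^n)`; the sequence
takes its values in `[0, log₂ |A|]`. -/
noncomputable def condEntropyRate {Ω A B : Type*} [MeasurableSpace Ω] [Fintype A] [Fintype B]
    (μ : Measure Ω) (X : ℤ → Ω → A) (Y : ℤ → Ω → B) : ℝ :=
  limsup (fun n : ℕ => condEntropy μ X Y n / (n : ℝ)) atTop

/-! ### The coefficients `γ` -/

/-- The σ-algebra generated by the variables `Z_k`, `k ∈ S`. -/
abbrev sigmaGen {Ω A : Type*} [MeasurableSpace A] (Z : ℤ → Ω → A) (S : Set ℤ) :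
    MeasurableSpace Ω :=
  ⨆ k ∈ S, MeasurableSpace.comap (Z k) inferInstance

/-- `|log₂ p - log₂ q|` for `p, q ≥ 0`, with values in `[0, ∞]`: since `log₂ 0 = -∞`, it is
`∞` if exactly one of `p, q` vanishes; it is `0` if both vanish. -/
noncomputable def logDist (p q : ℝ) : ℝ≥0∞ :=
  if p = q then 0
  else if p = 0 ∨ q = 0 then ⊤
  else ENNReal.ofReal |Real.logb 2 p - Real.logb 2 q|

/-- `γ^{(Z)}(d) = max_z 𝔼 |log₂ ℙ(Z_0 = z | Z_{-∞}^{-1}) - log₂ ℙ(Z_0 = z | Z_{-d}^{-1})|`,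
with values in `[0, ∞]`. -/
noncomputable def gammaCoeff {Ω A : Type*} {mΩ : MeasurableSpace Ω} [MeasurableSpace A]
    (μ : Measure Ω) (Z : ℤ → Ω → A) (d : ℕ) : ℝ≥0∞ :=
  ⨆ z : A, ∫⁻ ω, logDist
    ((μ⟦Z 0 ⁻¹' {z} | sigmaGen Z (Set.Iic (-1))⟧) ω)
    ((μ⟦Z 0 ⁻¹' {z} | sigmaGen Z (Set.Icc (-(d : ℤ)) (-1))⟧) ω) ∂μ

end SideInfo

set_option linter.unusedSectionVars false

/-! Write z = (x, y). On the path space of the joint process, R_n P(x_1^n | y_1^n) is squeezed by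
two applications of one scheme: a nonnegative variable whose integral grows at most linearly in n is
eventually below (n+1)^3 by Markov's inequality and Borel–Cantelli
(`ae_eventually_lt_of_lintegral_le`). Each application costs 3 log(n+1).

Upper bound. R_n is at most the number of occurrences of y_1^n before z_1^n recurs. Shifting each
such occurrence to the origin gives disjoint events inside {y_1^n}, so the integral of R_n over
{z_1^n} is at most P(y_1^n), a conditional Kac inequality (`setLIntegral_jointRecTime_le`). Hence
R_n P(x_1^n | y_1^n) has mean at most 1.

Lower bound. Once the past and y_1^n are fixed, a finite R_n determines x_1^n, so the sum of 1/R_n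
over all x_1^n is at most 2 + n log|A|, by comparison with the harmonic series. Dividing by the
conditional law given the infinite past turns such sums into integrals (`lintegral_mul_pastInv_le`).
The result is log[R_n P(x_1^n | y_1^n)] ≥ -G_n - 3 log(n+1), with the gap G_n = log P(z_1^n |
z_{-∞}^0) - log P(z_1^n).

It remains to bound G_n from above. In (a), the chain rule writes G_n as a sum of differences whose
mean absolute values are controlled by γ, so it is almost surely bounded above in n. In (b), log
P(z_1^n | z_{-∞}^0) is a Birkhoff sum and P(z_1^n) is compared with a Markov approximation of high
order; a one-sided ergodic bound (`ae_exists_birkhoffSum_le`) for each gives G_n ≤ εn. The same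
ingredients yield the Shannon–McMillan–Breiman theorem, which, used for (X,Y) and for Y, gives the
limit, since H(X|Y) = H(X,Y) - H(Y). -/

namespace SideInfo

/-! ### The maximal ergodic inequality and one-sided bounds on Birkhoff sums -/

section Ergodic

variable {α : Type*}

/-- The maximum `max_{0 ≤ n ≤ N} S_n g` of the Birkhoff sums. -/
noncomputable def maxBirkhoff (T : α → α) (g : α → ℝ) : ℕ → α → ℝ
  | 0 => fun _ => 0
  | N + 1 => fun x => max 0 (g x + maxBirkhoff T g N (T x))

lemma maxBirkhoff_nonneg (T : α → α) (g : α → ℝ) (N : ℕ) (x : α) :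
    0 ≤ maxBirkhoff T g N x := by
  cases N with
  | zero => exact le_rfl
  | succ N => exact le_max_left _ _

lemma maxBirkhoff_le_succ (T : α → α) (g : α → ℝ) (N : ℕ) (x : α) :
    maxBirkhoff T g N x ≤ maxBirkhoff T g (N + 1) x := by
  induction N generalizing x with
  | zero => exact maxBirkhoff_nonneg T g 1 x
  | succ N ih => exact max_le_max le_rfl (by linarith [ih (T x)])

lemma birkhoffSum_le_maxBirkhoff (T : α → α) (g : α → ℝ) (N : ℕ) (x : α) :
    birkhoffSum T g N x ≤ maxBirkhoff T g N x := by
  induction N generalizing x with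
  | zero => simp [maxBirkhoff]
  | succ N ih =>
    rw [birkhoffSum_succ']
    exact le_max_of_le_right (by linarith [ih (T x)])

variable [MeasurableSpace α] {ν : Measure α} {T : α → α}

lemma integrable_maxBirkhoff (hT : MeasurePreserving T ν ν) {g : α → ℝ} (hg : Integrable g ν)
    (N : ℕ) : Integrable (maxBirkhoff T g N) ν := by
  induction N with
  | zero => exact integrable_zero _ _ _
  | succ N ih =>
    exact (integrable_zero _ _ _).sup (hg.add (hT.integrable_comp_of_integrable ih))

lemma measurable_maxBirkhoff (hT : Measurable T) {g : α → ℝ} (hg : Measurable g)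
    (N : ℕ) : Measurable (maxBirkhoff T g N) := by
  induction N with
  | zero => exact measurable_const
  | succ N ih => exact measurable_const.max (hg.add (ih.comp hT))

/-- Maximal ergodic inequality. -/
lemma setIntegral_maxBirkhoff_nonneg (hT : MeasurePreserving T ν ν) {g : α → ℝ}
    (hgm : Measurable g) (hg : Integrable g ν) (N : ℕ) :
    0 ≤ ∫ x in {x | 0 < maxBirkhoff T g (N + 1) x}, g x ∂ν := by
  set E := {x | 0 < maxBirkhoff T g (N + 1) x}
  have hE : MeasurableSet E :=
    measurableSet_lt measurable_const (measurable_maxBirkhoff hT.measurable hgm _)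
  have h1 := integrable_maxBirkhoff hT hg (N + 1)
  have h0 := integrable_maxBirkhoff hT hg N
  have h0T : Integrable (fun x => maxBirkhoff T g N (T x)) ν :=
    hT.integrable_comp_of_integrable h0
  -- Where the maximum is positive it equals g plus the previous maximum at T x; elsewhere it is
  -- zero and the left side is nonpositive. By invariance and monotonicity in N the left integral is
  -- nonnegative.
  have key : ∫ x, (maxBirkhoff T g (N + 1) x - maxBirkhoff T g N (T x)) ∂ν
      ≤ ∫ x, E.indicator g x ∂ν := by
    refine integral_mono (h1.sub h0T) (hg.indicator hE) fun x => ?_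
    by_cases hx : x ∈ E
    · have hx' : 0 < max 0 (g x + maxBirkhoff T g N (T x)) := hx
      have : maxBirkhoff T g (N + 1) x = g x + maxBirkhoff T g N (T x) := by
        change max 0 (g x + maxBirkhoff T g N (T x)) = _
        rcases le_total (g x + maxBirkhoff T g N (T x)) 0 with h | h
        · rw [max_eq_left h] at hx'
          exact absurd hx' (lt_irrefl _)
        · exact max_eq_right h
      simp [Set.indicator_of_mem hx, this]
    · have : maxBirkhoff T g (N + 1) x = 0 :=
        le_antisymm (not_lt.1 hx) (maxBirkhoff_nonneg T g _ x)
      simp [Set.indicator_of_notMem hx, this, maxBirkhoff_nonneg]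
  rw [integral_indicator hE, integral_sub h1 h0T] at key
  have hcomp : ∫ x, maxBirkhoff T g N (T x) ∂ν = ∫ x, maxBirkhoff T g N x ∂ν := by
    have := integral_map (μ := ν) hT.measurable.aemeasurable
      (f := maxBirkhoff T g N) (by
        rw [hT.map_eq]
        exact h0.aestronglyMeasurable)
    rw [← this, hT.map_eq]
  have hmono := integral_mono h0 h1 (maxBirkhoff_le_succ T g N)
  linarith

/-- For an ergodic transformation, the Birkhoff sums of a function `f` with `∫ f < a` stay, almost
surely, below `a n` up to a random constant. -/
theorem ae_exists_birkhoffSum_le [IsProbabilityMeasure ν] (hT : Ergodic T ν) {f : α → ℝ}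
    (hfm : Measurable f) (hf : Integrable f ν) {a : ℝ} (ha : ∫ x, f x ∂ν < a) :
    ∀ᵐ x ∂ν, ∃ K : ℝ, ∀ n : ℕ, birkhoffSum T f n x ≤ a * n + K := by
  have hmp := hT.toMeasurePreserving
  set g : α → ℝ := fun x => f x - a
  have hgm : Measurable g := hfm.sub_const a
  have hg : Integrable g ν := hf.sub (integrable_const a)
  have hgneg : ∫ x, g x ∂ν < 0 := by
    simp only [g]
    rw [integral_sub hf (integrable_const a)]
    simpa using ha
  have hSm : ∀ n, Measurable (birkhoffSum T g n) := fun n =>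
    Finset.measurable_fun_sum _ fun k _ => hgm.comp (hmp.measurable.iterate k)
  -- Unboundedness of the sums is an invariant event. Were it of full measure, the sets of the
  -- maximal inequality would exhaust the space and force ∫ g ≥ 0.
  set E : Set α := {x | ∀ K : ℕ, ∃ n : ℕ, (K : ℝ) < birkhoffSum T g n x}
  have hE : MeasurableSet E := by
    have : E = ⋂ K : ℕ, ⋃ n : ℕ, {x | (K : ℝ) < birkhoffSum T g n x} := by
      ext x; simp [E]
    rw [this]
    exact MeasurableSet.iInter fun K => MeasurableSet.iUnion fun n =>
      measurableSet_lt measurable_const (hSm n)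
  have hinv : T ⁻¹' E = E := by
    ext x
    constructor
    · intro hx K
      obtain ⟨L, hL⟩ := exists_nat_gt ((K : ℝ) - g x)
      obtain ⟨n, hn⟩ := hx L
      refine ⟨n + 1, ?_⟩
      rw [birkhoffSum_succ']
      linarith
    · intro hx K
      obtain ⟨L, hL⟩ := exists_nat_gt ((K : ℝ) + g x)
      obtain ⟨n, hn⟩ := hx (max L 0)
      rcases n with _ | n
      · simp at hn
        exact absurd hn (not_lt.2 (Nat.cast_nonneg L))
      · refine ⟨n, ?_⟩
        rw [birkhoffSum_succ'] at hn
        simp at hn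
        linarith
  have hnot : ∀ᵐ x ∂ν, x ∉ E := by
    rcases hT.toPreErgodic.ae_mem_or_ae_notMem hE hinv with h' | h'
    · exfalso
      have hlim : Tendsto (fun N => ∫ x, {x | 0 < maxBirkhoff T g (N + 1) x}.indicator g x ∂ν)
          atTop (𝓝 (∫ x, g x ∂ν)) := by
        refine tendsto_integral_of_dominated_convergence (fun x => |g x|) (fun N => ?_) hg.abs
          (fun N => ?_) ?_
        · exact (hgm.indicator (measurableSet_lt measurable_const
            (measurable_maxBirkhoff hmp.measurable hgm _))).aestronglyMeasurable
        · filter_upwards with x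
          exact (norm_indicator_le_norm_self g x)
        · filter_upwards [h'] with x hx
          obtain ⟨n, hn⟩ := hx 0
          refine tendsto_const_nhds.congr' ?_
          filter_upwards [eventually_ge_atTop n] with N hN
          have hmono : Monotone fun N => maxBirkhoff T g N x :=
            monotone_nat_of_le_succ fun N => maxBirkhoff_le_succ T g N x
          have : 0 < maxBirkhoff T g (N + 1) x := by
            refine lt_of_lt_of_le ?_ (hmono (hN.trans N.le_succ))
            refine lt_of_lt_of_le ?_ (birkhoffSum_le_maxBirkhoff T g n x)
            simpa using hn
          rw [Set.indicator_of_mem (show x ∈ {x | 0 < maxBirkhoff T g (N + 1) x} from this)]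
      have := ge_of_tendsto' hlim fun N => by
        rw [integral_indicator (measurableSet_lt measurable_const
            (measurable_maxBirkhoff hmp.measurable hgm _))]
        exact setIntegral_maxBirkhoff_nonneg hmp hgm hg N
      linarith
    · exact h'
  filter_upwards [hnot] with x hx
  simp only [E, Set.mem_ofPred_eq, not_forall, not_exists, not_lt] at hx
  obtain ⟨K, hK⟩ := hx
  refine ⟨K, fun n => ?_⟩
  have h1 : birkhoffSum T g n x = birkhoffSum T f n x - a * n := by
    simp [birkhoffSum, g, Finset.sum_sub_distrib, mul_comm]
  linarith [hK n]

end Ergodic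

/-! ### Conditional probabilities -/

section CondProb

variable {Ω S : Type*} {mΩ : MeasurableSpace Ω} {m mS : MeasurableSpace S}
  {μ : Measure Ω} {ν : Measure S}

/-- Conditional expectations commute with composition by a measure preserving map. -/
lemma condExp_comp_measurePreserving [IsFiniteMeasure μ] [IsFiniteMeasure ν] {φ : Ω → S}
    (hφ : MeasurePreserving φ μ ν) (hm : m ≤ mS) {f : S → ℝ}
    (hf : Integrable f ν) :
    μ[f ∘ φ | m.comap φ] =ᵐ[μ] (ν[f | m]) ∘ φ := by
  have hm' : m.comap φ ≤ mΩ :=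
    (MeasurableSpace.comap_mono hm).trans hφ.measurable.comap_le
  have hset : ∀ {h : S → ℝ}, Integrable h ν → ∀ t, MeasurableSet[mS] t →
      ∫ x in φ ⁻¹' t, (h ∘ φ) x ∂μ = ∫ x in t, h x ∂ν := by
    intro h hh t ht
    rw [← hφ.map_eq] at hh ⊢
    rw [setIntegral_map ht hh.aestronglyMeasurable hφ.measurable.aemeasurable]
    rfl
  symm
  refine ae_eq_condExp_of_forall_setIntegral_eq hm' (hφ.integrable_comp_of_integrable hf)
    (fun s _ _ => (hφ.integrable_comp_of_integrable integrable_condExp).integrableOn) ?_ ?_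
  · rintro s ⟨t, ht, rfl⟩ -
    rw [hset integrable_condExp t (hm t ht), hset hf t (hm t ht), setIntegral_condExp hm hf ht]
  · have : Measurable[m.comap φ, m] φ := comap_measurable φ
    exact (stronglyMeasurable_condExp.comp_measurable this).aestronglyMeasurable

lemma condProb_comp_measurePreserving [IsFiniteMeasure μ] [IsFiniteMeasure ν] {φ : Ω → S}
    (hφ : MeasurePreserving φ μ ν) (hm : m ≤ mS) {s : Set S}
    (hs : MeasurableSet s) :
    μ⟦φ ⁻¹' s | m.comap φ⟧ =ᵐ[μ] (ν⟦s | m⟧) ∘ φ := by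
  have := condExp_comp_measurePreserving hφ hm
    ((integrable_const (1 : ℝ)).indicator hs : Integrable (s.indicator fun _ => (1 : ℝ)) ν)
  exact this

lemma condProb_nonneg (s : Set S) : ∀ᵐ x ∂ν, 0 ≤ (ν⟦s | m⟧) x :=
  condExp_nonneg (ae_of_all _ fun _ => Set.indicator_nonneg (fun _ _ => zero_le_one) _)

lemma condProb_le_one [IsFiniteMeasure ν] (hm : m ≤ mS) {s : Set S}
    (hs : MeasurableSet s) : ∀ᵐ x ∂ν, (ν⟦s | m⟧) x ≤ 1 := by
  have h := condExp_mono (m := m) ((integrable_const (1 : ℝ)).indicator hs)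
    (integrable_const (μ := ν) (1 : ℝ))
    (ae_of_all _ fun x => Set.indicator_le_self' (fun _ _ => zero_le_one) x)
  rw [condExp_const hm] at h
  exact h

/-- The restriction of ν to s and the measure with density the conditional probability of s agree on
m, and an m-measurable H sees no more. Working in [0, ∞] avoids integrability conditions on H. -/
lemma setLIntegral_eq_lintegral_mul_condProb [IsFiniteMeasure ν]
    (hm : m ≤ mS) {s : Set S} (hs : MeasurableSet s) {H : S → ℝ≥0∞} (hH : Measurable[m] H) :
    ∫⁻ x in s, H x ∂ν = ∫⁻ x, H x * ENNReal.ofReal ((ν⟦s | m⟧) x) ∂ν := by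
  have hp : Measurable[m] fun x => ENNReal.ofReal ((ν⟦s | m⟧) x) :=
    stronglyMeasurable_condExp.measurable.ennreal_ofReal
  have heq : (ν.restrict s).trim hm
      = (ν.withDensity fun x => ENNReal.ofReal ((ν⟦s | m⟧) x)).trim hm := by
    refine @Measure.ext _ m _ _ fun t ht => ?_
    rw [trim_measurableSet_eq hm ht, trim_measurableSet_eq hm ht, withDensity_apply _ (hm t ht),
      Measure.restrict_apply (hm t ht), ← ofReal_integral_eq_lintegral_ofReal
        integrable_condExp.integrableOn (ae_restrict_of_ae (condProb_nonneg s)),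
      setIntegral_condExp hm ((integrable_const (1 : ℝ)).indicator hs) ht,
      setIntegral_indicator hs]
    simp [measureReal_def]
  rw [← lintegral_trim hm hH, heq, lintegral_trim hm hH,
    lintegral_withDensity_eq_lintegral_mul _ (hp.mono hm le_rfl) (hH.mono hm le_rfl)]
  simp [mul_comm]

/-- Pulling out H / p leaves H · p⁻¹ · p, and p⁻¹ · p ≤ 1 in [0, ∞], with value 0 where p vanishes;
equality may fail there. -/
lemma setLIntegral_mul_inv_condProb_le [IsFiniteMeasure ν]
    (hm : m ≤ mS) {s : Set S} (hs : MeasurableSet s) {H : S → ℝ≥0∞} (hH : Measurable[m] H) :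
    ∫⁻ x in s, H x * (ENNReal.ofReal ((ν⟦s | m⟧) x))⁻¹ ∂ν ≤ ∫⁻ x, H x ∂ν := by
  have hp : Measurable[m] fun x => ENNReal.ofReal ((ν⟦s | m⟧) x) :=
    stronglyMeasurable_condExp.measurable.ennreal_ofReal
  refine (setLIntegral_eq_lintegral_mul_condProb hm hs (hH.mul hp.inv)).trans_le ?_
  refine lintegral_mono fun x => ?_
  simp only [Pi.mul_apply, Pi.inv_apply]
  rw [mul_assoc]
  exact mul_le_of_le_one_right' (ENNReal.inv_mul_le_one _)

/-- Testing against the m-measurable event that the conditional probability vanishes shows that this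
event meets s in a null set. -/
lemma condProb_pos_of_mem [IsFiniteMeasure ν]
    (hm : m ≤ mS) {s : Set S} (hs : MeasurableSet s) :
    ∀ᵐ x ∂ν, x ∈ s → 0 < (ν⟦s | m⟧) x := by
  have hpm : Measurable[m] (ν⟦s | m⟧) := stronglyMeasurable_condExp.measurable
  set Z : Set S := {x | (ν⟦s | m⟧) x ≤ 0}
  have hZ : MeasurableSet[m] Z := hpm measurableSet_Iic
  have hZ1 : Measurable[m] (Z.indicator (1 : S → ℝ≥0∞)) :=
    (@measurable_const _ _ _ m (1 : ℝ≥0∞)).indicator hZ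
  have h := setLIntegral_eq_lintegral_mul_condProb (ν := ν) hm hs hZ1
  have h0 : ∫⁻ x, Z.indicator 1 x * ENNReal.ofReal ((ν⟦s | m⟧) x) ∂ν = 0 := by
    rw [lintegral_eq_zero_iff']
    · refine ae_of_all _ fun x => ?_
      by_cases hx : x ∈ Z
      · simp [ENNReal.ofReal_of_nonpos hx]
      · simp [hx]
    · exact ((hZ1.mul hpm.ennreal_ofReal).mono hm le_rfl).aemeasurable
  rw [h0, lintegral_indicator_one (hm _ hZ), Measure.restrict_apply (hm _ hZ)] at h
  have : ∀ᵐ x ∂ν, x ∉ Z ∩ s := measure_eq_zero_iff_ae_notMem.1 h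
  filter_upwards [this] with x hx hxs
  by_contra hneg
  exact hx ⟨not_lt.1 hneg, hxs⟩

end CondProb

/-! ### Path space -/

section PathSpace

variable {A : Type*}

/-- The shift by `m` places on two-sided sequences. -/
def shiftBy (m : ℤ) (x : ℤ → A) : ℤ → A := fun k => x (k + m)

/-- The coordinate process on path space. -/
def coord (A : Type*) : ℤ → (ℤ → A) → A := fun k x => x k

lemma shiftBy_apply (m k : ℤ) (x : ℤ → A) : shiftBy m x k = x (k + m) := rfl

lemma shiftBy_shiftBy (m l : ℤ) (x : ℤ → A) : shiftBy m (shiftBy l x) = shiftBy (m + l) x := by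
  funext k
  simp [shiftBy, add_assoc]

@[simp] lemma shiftBy_zero (x : ℤ → A) : shiftBy 0 x = x := by
  funext k
  simp [shiftBy]

lemma shift_iterate (n : ℕ) (x : ℤ → A) : shift^[n] x = shiftBy n x := by
  induction n generalizing x with
  | zero => simp
  | succ n ih =>
    rw [Function.iterate_succ_apply, ih]
    funext k
    simp [shiftBy, shift, add_assoc]

lemma block_shiftBy (x : ℤ → A) (j m : ℤ) (n : ℕ) :
    block (shiftBy j x) m n = block x (m + j) n := by
  funext k
  simp only [block, shiftBy]
  congr 1
  ring

lemma block_succ (x : ℤ → A) (m : ℤ) (n : ℕ) :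
    block x m (n + 1) = Fin.snoc (α := fun _ => A) (block x m n) (x (m + 1 + n)) := by
  funext k
  refine Fin.lastCases ?_ (fun i => ?_) k
  · simp [block]
  · simp [block]

lemma block_congr {x y : ℤ → A} {m : ℤ} {n : ℕ} (h : ∀ k, m < k → k ≤ m + n → x k = y k) :
    block x m n = block y m n := by
  funext k
  have := k.isLt
  exact h _ (by omega) (by omega)

lemma block_apply_of_mem (x : ℤ → A) {m : ℤ} {n : ℕ} {k : ℤ} (h1 : m < k) (h2 : k ≤ m + n) :
    x k = block x m n ⟨(k - m - 1).toNat, by omega⟩ := by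
  simp only [block]
  congr 1
  omega

variable [MeasurableSpace A]

lemma measurable_shiftBy (m : ℤ) : Measurable (shiftBy m : (ℤ → A) → (ℤ → A)) :=
  measurable_pi_lambda _ fun _ => measurable_pi_apply _

lemma sigmaGen_coord_le (S : Set ℤ) :
    sigmaGen (coord A) S ≤ (MeasurableSpace.pi : MeasurableSpace (ℤ → A)) :=
  iSup₂_le fun k _ => (measurable_pi_apply k).comap_le

lemma sigmaGen_mono {Ω : Type*} (Z : ℤ → Ω → A) {S S' : Set ℤ} (h : S ⊆ S') :
    sigmaGen Z S ≤ sigmaGen Z S' :=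
  biSup_mono h

lemma measurable_sigmaGen {Ω : Type*} (Z : ℤ → Ω → A) {S : Set ℤ} {k : ℤ} (hk : k ∈ S) :
    Measurable[sigmaGen Z S] (Z k) :=
  Measurable.mono (comap_measurable (Z k))
    (le_biSup (fun k => MeasurableSpace.comap (Z k) inferInstance) hk) le_rfl

lemma measurable_coord_sigmaGen {S : Set ℤ} {k : ℤ} (hk : k ∈ S) :
    Measurable[sigmaGen (coord A) S] fun x : ℤ → A => x k :=
  measurable_sigmaGen (coord A) hk

lemma measurable_block_sigmaGen {S : Set ℤ} {m : ℤ} {n : ℕ} (h : Set.Ioc m (m + n) ⊆ S) :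
    Measurable[sigmaGen (coord A) S] fun x : ℤ → A => block x m n := by
  refine @measurable_pi_lambda _ _ _ (sigmaGen (coord A) S) _ _ fun k => ?_
  have := k.isLt
  exact measurable_coord_sigmaGen (h ⟨by omega, by omega⟩)

@[fun_prop]
lemma measurable_block (m : ℤ) (n : ℕ) : Measurable fun x : ℤ → A => block x m n :=
  measurable_pi_lambda _ fun _ => measurable_pi_apply _

lemma measurable_shiftBy_sigmaGen {S S' : Set ℤ} {j : ℤ} (h : ∀ k ∈ S', k + j ∈ S) :
    Measurable[sigmaGen (coord A) S, sigmaGen (coord A) S'] (shiftBy j : (ℤ → A) → (ℤ → A)) := by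
  rw [measurable_iff_comap_le, MeasurableSpace.comap_iSup]
  refine iSup_le fun k => ?_
  rw [MeasurableSpace.comap_iSup]
  refine iSup_le fun hk => ?_
  rw [MeasurableSpace.comap_comp]
  exact (measurable_coord_sigmaGen (A := A) (h k hk)).comap_le

variable {ν : Measure (ℤ → A)}

lemma measurePreserving_shiftBy (hν : MeasurePreserving shift ν ν) (m : ℤ) :
    MeasurePreserving (shiftBy m) ν ν := by
  have hnat : ∀ n : ℕ, MeasurePreserving (shiftBy (n : ℤ)) ν ν := fun n => by
    have := hν.iterate n
    rwa [show (shift^[n] : (ℤ → A) → _) = shiftBy n from funext (shift_iterate n)] at this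
  obtain ⟨n, rfl | rfl⟩ := m.eq_nat_or_neg
  · exact hnat n
  · refine ⟨measurable_shiftBy _, ?_⟩
    conv_lhs => rw [← (hnat n).map_eq]
    rw [Measure.map_map (measurable_shiftBy _) (measurable_shiftBy _)]
    have : (shiftBy (-(n : ℤ)) ∘ shiftBy (n : ℤ) : (ℤ → A) → (ℤ → A)) = id := by
      funext x
      simp [shiftBy_shiftBy]
    rw [this, Measure.map_id]

lemma lintegral_shiftBy (hν : MeasurePreserving shift ν ν) (m : ℤ) {f : (ℤ → A) → ℝ≥0∞}
    (hf : Measurable f) : ∫⁻ x, f (shiftBy m x) ∂ν = ∫⁻ x, f x ∂ν :=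
  (measurePreserving_shiftBy hν m).lintegral_comp hf

lemma ae_shiftBy (hν : MeasurePreserving shift ν ν) {p : (ℤ → A) → Prop}
    (h : ∀ᵐ x ∂ν, p x) : ∀ᵐ x ∂ν, ∀ m : ℤ, p (shiftBy m x) :=
  ae_all_iff.2 fun m => (measurePreserving_shiftBy hν m).quasiMeasurePreserving.ae h

end PathSpace

/-! ### Probabilities of words -/

section Words

variable {A : Type*} [MeasurableSpace A]

/-- The probability of the word `b`. -/
noncomputable def wordProb (ν : Measure (ℤ → A)) (n : ℕ) (b : Fin n → A) : ℝ :=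
  ν.real {x | block x 0 n = b}

/-- The conditional probability of the letter `a` given that the preceding word is `b`. -/
noncomputable def transProb (ν : Measure (ℤ → A)) (d : ℕ) (b : Fin d → A) (a : A) : ℝ :=
  wordProb ν (d + 1) (Fin.snoc (α := fun _ => A) b a) / wordProb ν d b

/-- The probability `P(x_1^n)`. -/
noncomputable def blockProb (ν : Measure (ℤ → A)) (n : ℕ) (x : ℤ → A) : ℝ :=
  wordProb ν n (block x 0 n)

/-- The conditional probability `P(x_0 | x_{-d}^{-1})`. -/
noncomputable def stepProb (ν : Measure (ℤ → A)) (d : ℕ) (x : ℤ → A) : ℝ :=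
  transProb ν d (block x (-(d : ℤ) - 1) d) (x 0)

/-- The conditional probability of `x_0 = a` given the coordinates in `S`. -/
noncomputable def pastProb (ν : Measure (ℤ → A)) (S : Set ℤ) (a : A) : (ℤ → A) → ℝ :=
  ν⟦coord A 0 ⁻¹' {a} | sigmaGen (coord A) S⟧

/-- The conditional probability of the present letter `x_0` given the coordinates in `S`. -/
noncomputable def ownProb (ν : Measure (ℤ → A)) (S : Set ℤ) (x : ℤ → A) : ℝ :=
  pastProb ν S (x 0) x

variable {ν : Measure (ℤ → A)}

lemma wordProb_nonneg (n : ℕ) (b : Fin n → A) : 0 ≤ wordProb ν n b := measureReal_nonneg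

lemma transProb_nonneg (d : ℕ) (b : Fin d → A) (a : A) : 0 ≤ transProb ν d b a :=
  div_nonneg (wordProb_nonneg _ _) (wordProb_nonneg _ _)

lemma stepProb_eq_div (x : ℤ → A) (d : ℕ) (m : ℤ) :
    stepProb ν d (shiftBy (m + 1 + d) x) =
      wordProb ν (d + 1) (block x m (d + 1)) / wordProb ν d (block x m d) := by
  rw [stepProb, transProb, block_shiftBy, block_succ x m d, shiftBy_apply]
  have : -(d : ℤ) - 1 + (m + 1 + d) = m := by ring
  rw [this]
  simp

lemma measureReal_block_eq [Finite A] [MeasurableSingletonClass A]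
    (hν : MeasurePreserving shift ν ν) (m : ℤ) (n : ℕ) (b : Fin n → A) :
    ν.real {x | block x m n = b} = wordProb ν n b := by
  have hs : MeasurableSet {x : ℤ → A | block x 0 n = b} :=
    measurable_block 0 n (measurableSet_singleton b)
  have := (measurePreserving_shiftBy hν m).measureReal_preimage hs.nullMeasurableSet
  rw [wordProb, ← this]
  congr 1
  ext x
  simp [block_shiftBy]

variable [Fintype A] [MeasurableSingletonClass A]

lemma measurable_blockProb (n : ℕ) : Measurable (blockProb ν n) :=
  (measurable_of_finite (wordProb ν n)).comp (measurable_block 0 n)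

lemma measurable_stepProb (d : ℕ) : Measurable (stepProb ν d) := by
  have : Measurable fun p : (Fin d → A) × A => transProb ν d p.1 p.2 := measurable_of_finite _
  exact this.comp ((measurable_block _ _).prodMk (measurable_pi_apply 0))

lemma measurable_ownProb (S : Set ℤ) {S' : Set ℤ} (h : S ⊆ S') (h0 : 0 ∈ S') :
    Measurable[sigmaGen (coord A) S'] (ownProb ν S) := by
  classical
  have heq : ownProb ν S = fun x => ∑ a : A, if x 0 = a then pastProb ν S a x else 0 := by
    funext x
    simp [ownProb]
  rw [heq]
  refine Finset.measurable_fun_sum _ fun a _ => Measurable.ite ?_ ?_ measurable_const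
  · exact measurable_coord_sigmaGen h0 (measurableSet_singleton a)
  · exact (stronglyMeasurable_condExp.measurable).mono (sigmaGen_mono _ h) le_rfl

lemma measurable_ownProb' (S : Set ℤ) : Measurable (ownProb ν S) :=
  (measurable_ownProb (ν := ν) S (Set.subset_univ S) (Set.mem_univ 0)).mono
    (sigmaGen_coord_le _) le_rfl

variable [IsProbabilityMeasure ν]

lemma sum_wordProb (n : ℕ) : ∑ b : Fin n → A, wordProb ν n b = 1 := by
  have := sum_measureReal_preimage_singleton (μ := ν) (f := fun x : ℤ → A => block x 0 n)
    Finset.univ (fun b _ => measurable_block 0 n (measurableSet_singleton b))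
  simpa [wordProb, Set.preimage] using this

lemma sum_wordProb_snoc (n : ℕ) (b : Fin n → A) :
    ∑ a : A, wordProb ν (n + 1) (Fin.snoc (α := fun _ => A) b a) = wordProb ν n b := by
  have hb : MeasurableSet {x : ℤ → A | block x 0 n = b} :=
    measurable_block 0 n (measurableSet_singleton b)
  have := sum_measureReal_preimage_singleton (μ := ν.restrict {x | block x 0 n = b})
    (f := fun x : ℤ → A => x (1 + n))
    Finset.univ (fun a _ => measurable_pi_apply _ (measurableSet_singleton a))
  rw [Finset.coe_univ, Set.preimage_univ] at this
  rw [measureReal_restrict_apply_univ] at this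
  rw [wordProb, ← this]
  refine Finset.sum_congr rfl fun a _ => ?_
  rw [measureReal_restrict_apply (measurable_pi_apply _ (measurableSet_singleton a)), wordProb]
  congr 1
  ext x
  simp [block_succ, and_comm]

lemma wordProb_snoc_le (n : ℕ) (b : Fin n → A) (a : A) :
    wordProb ν (n + 1) (Fin.snoc (α := fun _ => A) b a) ≤ wordProb ν n b := by
  rw [← sum_wordProb_snoc n b]
  exact Finset.single_le_sum (f := fun a => wordProb ν (n + 1) (Fin.snoc (α := fun _ => A) b a))
    (fun _ _ => wordProb_nonneg _ _) (Finset.mem_univ a)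

/-- The sum is 0, not 1, when b has probability zero, by the convention for division by zero. -/
lemma sum_transProb_le (d : ℕ) (b : Fin d → A) : ∑ a : A, transProb ν d b a ≤ 1 := by
  simp only [transProb]
  rw [← Finset.sum_div, sum_wordProb_snoc]
  exact div_self_le_one _

lemma ae_wordProb_pos (hν : MeasurePreserving shift ν ν) :
    ∀ᵐ x ∂ν, ∀ (m : ℤ) (n : ℕ), 0 < wordProb ν n (block x m n) := by
  refine ae_all_iff.2 fun m => ae_all_iff.2 fun n => ?_
  have : ∀ᵐ x ∂ν, ∀ b : Fin n → A, wordProb ν n b = 0 → block x m n ≠ b := by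
    refine ae_all_iff.2 fun b => ?_
    by_cases hb : wordProb ν n b = 0
    · rw [← measureReal_block_eq hν m n b, measureReal_eq_zero_iff] at hb
      filter_upwards [measure_eq_zero_iff_ae_notMem.1 hb] with x hx _ using hx
    · exact ae_of_all _ fun x h => absurd h hb
  filter_upwards [this] with x hx
  exact lt_of_le_of_ne (wordProb_nonneg _ _) fun h => hx _ h.symm rfl

/-- The chain rule: the factor with index i belongs to time i + 1 and conditions on the i letters
from time 1 on. Positivity lets the product telescope. -/
lemma blockProb_eq_prod {x : ℤ → A} (hx : ∀ n, 0 < blockProb ν n x) (n : ℕ) :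
    blockProb ν n x = ∏ i ∈ Finset.range n, stepProb ν i (shiftBy (i + 1) x) := by
  induction n with
  | zero =>
    have := sum_wordProb (ν := ν) 0
    simp only [Finset.univ_unique, Finset.sum_singleton] at this
    rw [Finset.range_zero, Finset.prod_empty, blockProb, ← this]
    congr 1
    exact Subsingleton.elim _ _
  | succ n ih =>
    have h := stepProb_eq_div (ν := ν) x n 0
    rw [Finset.prod_range_succ, ← ih, show ((n : ℤ) + 1) = 0 + 1 + n by ring, h]
    exact (mul_div_cancel₀ _ (hx n).ne').symm

lemma ae_blockProb_pos (hν : MeasurePreserving shift ν ν) : ∀ᵐ x ∂ν, ∀ n, 0 < blockProb ν n x := by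
  filter_upwards [ae_wordProb_pos hν] with x hx n using hx 0 n

lemma measureReal_eq_sum_indicator {W : Type*} [Fintype W] [MeasurableSpace W]
    [MeasurableSingletonClass W] (ρ : Measure W) [IsFiniteMeasure ρ] (t : Set W) :
    ρ.real t = ∑ b : W, ρ.real {b} * t.indicator 1 b := by
  have := integral_fintype (μ := ρ) (f := t.indicator (1 : W → ℝ)) Integrable.of_finite
  rw [integral_indicator_one (Set.toFinite t).measurableSet] at this
  simpa using this

/-- A finite window generates the same events as its block, which takes finitely many values; so the
ratio of word probabilities need only be integrated over unions of words. -/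
lemma pastProb_Icc_ae_eq (hν : MeasurePreserving shift ν ν) (d : ℕ) (a : A) :
    ∀ᵐ x ∂ν, pastProb ν (Set.Icc (-(d : ℤ)) (-1)) a x =
      transProb ν d (block x (-(d : ℤ) - 1) d) a := by
  set β : (ℤ → A) → (Fin d → A) := fun x => block x (-(d : ℤ) - 1) d
  have hβ : Measurable β := measurable_block _ _
  have hm := sigmaGen_coord_le (A := A) (Set.Icc (-(d : ℤ)) (-1))
  have hβm : Measurable[sigmaGen (coord A) (Set.Icc (-(d : ℤ)) (-1))] β :=
    measurable_block_sigmaGen fun k hk => ⟨by have := hk.1; omega, by have := hk.2; omega⟩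
  have hle : sigmaGen (coord A) (Set.Icc (-(d : ℤ)) (-1)) ≤ MeasurableSpace.comap β ⊤ := by
    refine iSup₂_le fun k hk => ?_
    have h1 : -(d : ℤ) - 1 < k := by have := hk.1; omega
    have h2 : k ≤ -(d : ℤ) - 1 + d := by have := hk.2; omega
    have : coord A k = (fun w : Fin d → A => w ⟨(k - (-(d : ℤ) - 1) - 1).toNat, by omega⟩) ∘ β := by
      funext x
      exact block_apply_of_mem x h1 h2
    rw [this, ← MeasurableSpace.comap_comp]
    exact MeasurableSpace.comap_mono le_top
  have ha : MeasurableSet (coord A 0 ⁻¹' {a}) :=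
    measurable_pi_apply 0 (measurableSet_singleton a)
  have hfm : Measurable (fun w : Fin d → A => transProb ν d w a) := measurable_of_finite _
  have hfin : Integrable (fun x => transProb ν d (β x) a) ν := by
    refine Integrable.of_bound (hfm.comp hβ).aestronglyMeasurable 1 (ae_of_all _ fun x => ?_)
    rw [Real.norm_of_nonneg (transProb_nonneg _ _ _)]
    exact (Finset.single_le_sum (f := fun a => transProb ν d (β x) a)
      (fun _ _ => transProb_nonneg _ _ _) (Finset.mem_univ a)).trans (sum_transProb_le _ _)
  have := ae_eq_condExp_of_forall_setIntegral_eq hm (f := (coord A 0 ⁻¹' {a}).indicator fun _ => (1:ℝ))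
    (g := fun x => transProb ν d (β x) a) ((integrable_const (1 : ℝ)).indicator ha)
    (fun s _ _ => hfin.integrableOn) (fun s hs _ => ?_)
    (hfm.comp hβm).stronglyMeasurable.aestronglyMeasurable
  · filter_upwards [this] with x hx using hx.symm
  · obtain ⟨t, -, rfl⟩ := hle s hs
    have ht : MeasurableSet t := (Set.toFinite t).measurableSet
    have h1 : ∫ x in β ⁻¹' t, transProb ν d (β x) a ∂ν
        = ∑ w : Fin d → A, wordProb ν d w * t.indicator (fun w => transProb ν d w a) w := by
      rw [← integral_indicator (hβ ht)]
      have h2 : ((β ⁻¹' t).indicator fun x => transProb ν d (β x) a)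
          = fun x => t.indicator (fun w => transProb ν d w a) (β x) := by
        funext x; rfl
      rw [h2, ← integral_map (μ := ν) hβ.aemeasurable (f := t.indicator fun w => transProb ν d w a)
        (measurable_of_finite _).aestronglyMeasurable]
      rw [integral_fintype Integrable.of_finite]
      refine Finset.sum_congr rfl fun w _ => ?_
      rw [smul_eq_mul, measureReal_def, Measure.map_apply hβ (measurableSet_singleton w),
        ← measureReal_block_eq hν (-(d : ℤ) - 1) d w]
      rfl
    rw [h1, setIntegral_indicator ha, setIntegral_const, smul_eq_mul, mul_one]
    have h3 : ν.real (β ⁻¹' t ∩ coord A 0 ⁻¹' {a})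
        = ((ν.restrict (coord A 0 ⁻¹' {a})).map β).real t := by
      rw [measureReal_def, measureReal_def, Measure.map_apply hβ ht,
        Measure.restrict_apply (hβ ht)]
    rw [h3, measureReal_eq_sum_indicator]
    refine Finset.sum_congr rfl fun w _ => ?_
    have h4 : ((ν.restrict (coord A 0 ⁻¹' {a})).map β).real {w}
        = wordProb ν (d + 1) (Fin.snoc (α := fun _ => A) w a) := by
      rw [measureReal_def, Measure.map_apply hβ (measurableSet_singleton w),
        Measure.restrict_apply (hβ (measurableSet_singleton w)),
        ← measureReal_block_eq hν (-(d : ℤ) - 1), measureReal_def]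
      congr 2
      ext x
      simp [block_succ, β, coord]
    rw [h4]
    by_cases hw : w ∈ t
    · simp only [Set.indicator_of_mem hw, Pi.one_apply, mul_one, transProb]
      -- A null word w has null extensions, so the value 0/0 = 0 is harmless.
      rcases eq_or_ne (wordProb ν d w) 0 with h0 | h0
      · have := wordProb_snoc_le (ν := ν) d w a
        rw [h0] at this ⊢
        simp [le_antisymm this (wordProb_nonneg _ _)]
      · rw [mul_div_cancel₀ _ h0]
    · simp [Set.indicator_of_notMem hw]

lemma stepProb_ae_eq_ownProb (hν : MeasurePreserving shift ν ν) (d : ℕ) :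
    stepProb ν d =ᵐ[ν] ownProb ν (Set.Icc (-(d : ℤ)) (-1)) := by
  filter_upwards [ae_all_iff.2 fun a => pastProb_Icc_ae_eq hν d a] with x hx
  rw [ownProb, hx]
  rfl

end Words

/-! ### Conditional entropies of the present given the past -/

section Entropy

variable {A : Type*} [MeasurableSpace A] [Fintype A] [MeasurableSingletonClass A]
  {ν : Measure (ℤ → A)} [IsProbabilityMeasure ν]

/-- The conditional entropy (in nats) of `x_0` given the coordinates in `S`. -/
noncomputable def entropyGiven (ν : Measure (ℤ → A)) (S : Set ℤ) : ℝ :=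
  ∫ x, -Real.log (ownProb ν S x) ∂ν

lemma measurableSet_coord_eq (a : A) : MeasurableSet (coord A 0 ⁻¹' {a}) :=
  measurable_pi_apply 0 (measurableSet_singleton a)

lemma pastProb_mem_Icc (S : Set ℤ) : ∀ᵐ x ∂ν, ∀ a, pastProb ν S a x ∈ Set.Icc (0 : ℝ) 1 := by
  refine ae_all_iff.2 fun a => ?_
  filter_upwards [condProb_nonneg (ν := ν) (m := sigmaGen (coord A) S) (coord A 0 ⁻¹' {a}),
    condProb_le_one (ν := ν) (sigmaGen_coord_le S) (measurableSet_coord_eq a)] with x h0 h1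
  exact ⟨h0, h1⟩

lemma ownProb_pos (S : Set ℤ) : ∀ᵐ x ∂ν, 0 < ownProb ν S x := by
  filter_upwards [ae_all_iff.2 fun a => condProb_pos_of_mem (ν := ν) (sigmaGen_coord_le S)
    (measurableSet_coord_eq a)] with x hx
  exact hx (x 0) rfl

lemma ownProb_le_one (S : Set ℤ) : ∀ᵐ x ∂ν, ownProb ν S x ≤ 1 := by
  filter_upwards [pastProb_mem_Icc (ν := ν) S] with x hx
  exact (hx _).2

lemma measurable_pastProb (S : Set ℤ) (a : A) : Measurable (pastProb ν S a) :=
  (stronglyMeasurable_condExp.measurable).mono (sigmaGen_coord_le S) le_rfl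

lemma lintegral_eq_sum_setLIntegral (f : (ℤ → A) → ℝ≥0∞) :
    ∫⁻ x, f x ∂ν = ∑ a : A, ∫⁻ x in coord A 0 ⁻¹' {a}, f x ∂ν := by
  rw [← lintegral_biUnion_finset (s := Finset.univ) ?_ fun a _ => measurableSet_coord_eq a]
  · have : ⋃ a ∈ (Finset.univ : Finset A), coord A 0 ⁻¹' {a} = Set.univ := by
      ext x; simp
    rw [this, setLIntegral_univ]
  · intro a _ b _ hab
    exact Disjoint.preimage _ (Set.disjoint_singleton.2 hab)

/-- Splitting by the letter x_0 and averaging -log p against its conditional probability p replaces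
the unbounded -log p by the bounded -p log p. Integrability and the convergence of entropies rest on
this. -/
lemma lintegral_neg_log_ownProb (S : Set ℤ) :
    ∫⁻ x, ENNReal.ofReal (-Real.log (ownProb ν S x)) ∂ν =
      ∑ a : A, ∫⁻ x, ENNReal.ofReal (Real.negMulLog (pastProb ν S a x)) ∂ν := by
  rw [lintegral_eq_sum_setLIntegral]
  refine Finset.sum_congr rfl fun a _ => ?_
  have h1 : ∫⁻ x in coord A 0 ⁻¹' {a}, ENNReal.ofReal (-Real.log (ownProb ν S x)) ∂ν
      = ∫⁻ x in coord A 0 ⁻¹' {a}, ENNReal.ofReal (-Real.log (pastProb ν S a x)) ∂ν := by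
    refine setLIntegral_congr_fun (measurableSet_coord_eq a) fun x hx => ?_
    have : x 0 = a := hx
    simp [ownProb, this]
  have hm : Measurable[sigmaGen (coord A) S]
      fun x => ENNReal.ofReal (-Real.log (pastProb ν S a x)) :=
    (Real.measurable_log.comp stronglyMeasurable_condExp.measurable).neg.ennreal_ofReal
  rw [h1, setLIntegral_eq_lintegral_mul_condProb (sigmaGen_coord_le S)
    (measurableSet_coord_eq a) hm]
  refine lintegral_congr_ae ?_
  filter_upwards [pastProb_mem_Icc (ν := ν) S] with x hx
  change _ * ENNReal.ofReal (pastProb ν S a x) = _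
  rw [← ENNReal.ofReal_mul' (hx a).1, Real.negMulLog]
  congr 1
  ring

lemma negMulLog_le_one {t : ℝ} (h0 : 0 ≤ t) : Real.negMulLog t ≤ 1 := by
  rcases h0.eq_or_lt with rfl | h
  · simp
  · have h2 := Real.one_sub_inv_le_log_of_pos h
    have h3 : t * (1 - t⁻¹) ≤ t * Real.log t := mul_le_mul_of_nonneg_left h2 h0
    rw [mul_sub, mul_inv_cancel₀ h.ne'] at h3
    rw [Real.negMulLog]
    linarith

lemma integrable_negMulLog_pastProb (S : Set ℤ) (a : A) :
    Integrable (fun x => Real.negMulLog (pastProb ν S a x)) ν := by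
  refine Integrable.of_bound
    (Real.continuous_negMulLog.measurable.comp (measurable_pastProb S a)).aestronglyMeasurable 1 ?_
  filter_upwards [pastProb_mem_Icc (ν := ν) S] with x hx
  rw [Real.norm_of_nonneg (Real.negMulLog_nonneg (hx a).1 (hx a).2)]
  exact negMulLog_le_one (hx a).1

lemma neg_log_ownProb_nonneg (S : Set ℤ) : 0 ≤ᵐ[ν] fun x => -Real.log (ownProb ν S x) := by
  filter_upwards [ownProb_pos (ν := ν) S, ownProb_le_one (ν := ν) S] with x h0 h1
  exact neg_nonneg.2 (Real.log_nonpos h0.le h1)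

lemma measurable_neg_log_ownProb (S : Set ℤ) :
    Measurable fun x => -Real.log (ownProb ν S x) :=
  (Real.measurable_log.comp (measurable_ownProb' S)).neg

lemma negMulLog_pastProb_nonneg (S : Set ℤ) (a : A) :
    0 ≤ᵐ[ν] fun x => Real.negMulLog (pastProb ν S a x) := by
  filter_upwards [pastProb_mem_Icc (ν := ν) S] with x hx
  exact Real.negMulLog_nonneg (hx a).1 (hx a).2

lemma integrable_neg_log_ownProb (S : Set ℤ) :
    Integrable (fun x => -Real.log (ownProb ν S x)) ν := by
  refine ⟨(measurable_neg_log_ownProb S).aestronglyMeasurable, ?_⟩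
  rw [hasFiniteIntegral_iff_ofReal (neg_log_ownProb_nonneg S), lintegral_neg_log_ownProb]
  refine ENNReal.sum_lt_top.2 fun a _ => ?_
  exact (hasFiniteIntegral_iff_ofReal (negMulLog_pastProb_nonneg S a)).1
    (integrable_negMulLog_pastProb S a).2

lemma entropyGiven_eq_sum (S : Set ℤ) :
    entropyGiven ν S = ∑ a : A, ∫ x, Real.negMulLog (pastProb ν S a x) ∂ν := by
  rw [entropyGiven, integral_eq_lintegral_of_nonneg_ae (neg_log_ownProb_nonneg S)
    (measurable_neg_log_ownProb S).aestronglyMeasurable, lintegral_neg_log_ownProb,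
    ENNReal.toReal_sum]
  · refine Finset.sum_congr rfl fun a _ => ?_
    rw [integral_eq_lintegral_of_nonneg_ae (negMulLog_pastProb_nonneg S a)
      (integrable_negMulLog_pastProb S a).1]
  · intro a _
    exact ((hasFiniteIntegral_iff_ofReal (negMulLog_pastProb_nonneg S a)).1
      (integrable_negMulLog_pastProb S a).2).ne

/-- The filtration of the past, uncovered from time `-1` backwards. -/
def pastFiltration (A : Type*) [MeasurableSpace A] :
    Filtration ℕ (MeasurableSpace.pi : MeasurableSpace (ℤ → A)) where
  seq d := sigmaGen (coord A) (Set.Icc (-(d : ℤ)) (-1))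
  mono' := fun i j hij => sigmaGen_mono _ (Set.Icc_subset_Icc_left (by omega))
  le' := fun _ => sigmaGen_coord_le _

lemma iSup_pastFiltration :
    ⨆ d, pastFiltration A d = sigmaGen (coord A) (Set.Iic (-1)) := by
  refine le_antisymm (iSup_le fun d => sigmaGen_mono _ fun k hk => hk.2) ?_
  refine iSup₂_le fun k hk => ?_
  have hk' : k ≤ -1 := hk
  refine le_iSup_of_le (-k).toNat ?_
  refine Measurable.comap_le (measurable_sigmaGen (coord A) ?_)
  exact ⟨by omega, hk'⟩

/-- Lévy's upward theorem as the window extends to the whole past. -/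
lemma tendsto_pastProb (a : A) : ∀ᵐ x ∂ν,
    Tendsto (fun d : ℕ => pastProb ν (Set.Icc (-(d : ℤ)) (-1)) a x) atTop
      (𝓝 (pastProb ν (Set.Iic (-1)) a x)) := by
  have := tendsto_ae_condExp (μ := ν) (ℱ := pastFiltration A)
    ((coord A 0 ⁻¹' {a}).indicator fun _ => (1 : ℝ))
  rw [iSup_pastFiltration] at this
  exact this

lemma tendsto_entropyGiven :
    Tendsto (fun d : ℕ => entropyGiven ν (Set.Icc (-(d : ℤ)) (-1))) atTop
      (𝓝 (entropyGiven ν (Set.Iic (-1)))) := by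
  simp only [entropyGiven_eq_sum]
  refine tendsto_finsetSum _ fun a _ => ?_
  refine tendsto_integral_of_dominated_convergence (fun _ => 1)
    (fun d => (integrable_negMulLog_pastProb _ a).1) (integrable_const 1) (fun d => ?_) ?_
  · filter_upwards [pastProb_mem_Icc (ν := ν) (Set.Icc (-(d : ℤ)) (-1))] with x hx
    rw [Real.norm_of_nonneg (Real.negMulLog_nonneg (hx a).1 (hx a).2)]
    exact negMulLog_le_one (hx a).1
  · filter_upwards [tendsto_pastProb (ν := ν) a] with x hx
    exact (Real.continuous_negMulLog.tendsto _).comp hx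

/-! ### The entropy of blocks -/

/-- The entropy (in nats) of the block `x_1^n`. -/
noncomputable def blockEntropy (ν : Measure (ℤ → A)) (n : ℕ) : ℝ :=
  ∑ b : Fin n → A, Real.negMulLog (wordProb ν n b)

lemma blockEntropy_eq_integral (n : ℕ) :
    blockEntropy ν n = ∫ x, -Real.log (blockProb ν n x) ∂ν := by
  have h := integral_map (μ := ν) (measurable_block (A := A) 0 n).aemeasurable
    (f := fun b => -Real.log (wordProb ν n b)) (measurable_of_finite _).aestronglyMeasurable
  simp only [blockProb]
  rw [← h, integral_fintype Integrable.of_finite, blockEntropy]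
  refine Finset.sum_congr rfl fun b _ => ?_
  rw [measureReal_def, Measure.map_apply (measurable_block 0 n) (measurableSet_singleton b),
    smul_eq_mul, Real.negMulLog, neg_mul, mul_neg]
  rfl

/-- The logarithm of the chain rule, integrated; stationarity moves each present letter to time 0.
The entropy rate is then a Cesàro limit. -/
lemma blockEntropy_eq_sum (hν : MeasurePreserving shift ν ν) (n : ℕ) :
    blockEntropy ν n =
      ∑ i ∈ Finset.range n, entropyGiven ν (Set.Icc (-(i : ℤ)) (-1)) := by
  have hint : ∀ i : ℕ, Integrable (fun x => -Real.log (stepProb ν i x)) ν := fun i => by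
    refine (integrable_neg_log_ownProb (ν := ν) (Set.Icc (-(i : ℤ)) (-1))).congr ?_
    filter_upwards [stepProb_ae_eq_ownProb hν i] with x hx
    rw [hx]
  have h1 : (fun x => -Real.log (blockProb ν n x)) =ᵐ[ν]
      fun x => ∑ i ∈ Finset.range n, -Real.log (stepProb ν i (shiftBy (i + 1) x)) := by
    filter_upwards [ae_blockProb_pos hν] with x hx
    have hprod := blockProb_eq_prod hx n
    rw [hprod, Real.log_prod, Finset.sum_neg_distrib]
    intro i hi h0
    rw [Finset.prod_eq_zero hi h0] at hprod
    exact (hx n).ne' hprod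
  rw [blockEntropy_eq_integral, integral_congr_ae h1, integral_finsetSum]
  · refine Finset.sum_congr rfl fun i _ => ?_
    have hmp := measurePreserving_shiftBy hν (i + 1)
    have h2 := integral_map (μ := ν) hmp.measurable.aemeasurable
      (f := fun x => -Real.log (stepProb ν i x)) (by rw [hmp.map_eq]; exact (hint i).1)
    rw [← h2, hmp.map_eq, entropyGiven]
    refine integral_congr_ae ?_
    filter_upwards [stepProb_ae_eq_ownProb hν i] with x hx
    rw [hx]
  · exact fun i _ => (measurePreserving_shiftBy hν _).integrable_comp_of_integrable (hint i)

lemma tendsto_blockEntropy_div (hν : MeasurePreserving shift ν ν) :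
    Tendsto (fun n : ℕ => blockEntropy ν n / n) atTop (𝓝 (entropyGiven ν (Set.Iic (-1)))) := by
  have := (tendsto_entropyGiven (ν := ν)).cesaro
  refine this.congr fun n => ?_
  rw [blockEntropy_eq_sum hν, div_eq_inv_mul]

end Entropy

/-! ### Change of measure to the conditional distribution given the past -/

section Past

variable {A : Type*} [MeasurableSpace A]

/-- The conditional probability `P(x_1^n | x_{-∞}^0)`. -/
noncomputable def pastBlockProb (ν : Measure (ℤ → A)) (n : ℕ) (x : ℤ → A) : ℝ :=
  ∏ i ∈ Finset.range n, ownProb ν (Set.Iic (-1)) (shiftBy (i + 1) x)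

/-- The inverse of `P(x_1^n | x_{-∞}^0)`, with values in `[0, ∞]`. -/
noncomputable def pastInv (ν : Measure (ℤ → A)) (n : ℕ) (x : ℤ → A) : ℝ≥0∞ :=
  ∏ i ∈ Finset.range n, (ENNReal.ofReal (ownProb ν (Set.Iic (-1)) (shiftBy (i + 1) x)))⁻¹

/-- The sequence that agrees with `x` up to time `0` and continues with the word `z`. -/
def splice (x : ℤ → A) (n : ℕ) (z : Fin n → A) : ℤ → A := fun k =>
  -- After time n the letter x_0 is repeated, so that for fixed z the whole sequence is a function
  -- of the past.
  if h : 0 < k ∧ k ≤ n then z ⟨(k - 1).toNat, by omega⟩ else x (min k 0)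

lemma block_splice (x : ℤ → A) (n : ℕ) (z : Fin n → A) : block (splice x n z) 0 n = z := by
  funext k
  have := k.isLt
  have h : 0 < (0 : ℤ) + 1 + (k : ℤ) ∧ (0 : ℤ) + 1 + (k : ℤ) ≤ n := by omega
  simp only [block, splice, dif_pos h]
  congr 1
  ext
  simp

lemma splice_of_nonpos (x : ℤ → A) (n : ℕ) (z : Fin n → A) {k : ℤ} (hk : k ≤ 0) :
    splice x n z k = x k := by
  have : ¬(0 < k ∧ k ≤ n) := by omega
  rw [splice, dif_neg this, min_eq_left hk]

lemma splice_block (x : ℤ → A) (n : ℕ) {k : ℤ} (hk : k ≤ n) :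
    splice x n (block x 0 n) k = x k := by
  rcases le_or_gt k 0 with h | h
  · exact splice_of_nonpos _ _ _ h
  · rw [splice, dif_pos ⟨h, hk⟩, block]
    congr 1
    change (0 : ℤ) + 1 + ((k - 1).toNat : ℤ) = k
    omega

lemma measurable_splice (n : ℕ) (z : Fin n → A) :
    Measurable[sigmaGen (coord A) (Set.Iic 0)] fun x => splice x n z := by
  refine @measurable_pi_lambda _ _ _ (sigmaGen (coord A) (Set.Iic 0)) _ _ fun k => ?_
  by_cases h : 0 < k ∧ k ≤ n
  · simp only [splice, dif_pos h]
    exact measurable_const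
  · simp only [splice, dif_neg h]
    exact measurable_coord_sigmaGen (min_le_right k 0)

variable [Fintype A] [MeasurableSingletonClass A]
  {ν : Measure (ℤ → A)} [IsProbabilityMeasure ν]

lemma pastBlockProb_pos (hν : MeasurePreserving shift ν ν) :
    ∀ᵐ x ∂ν, ∀ n, 0 < pastBlockProb ν n x := by
  filter_upwards [ae_shiftBy hν (ownProb_pos (ν := ν) (Set.Iic (-1)))] with x hx n
  exact Finset.prod_pos fun i _ => hx _

lemma pastInv_eq {n : ℕ} {x : ℤ → A} (hx : ∀ m : ℤ, 0 < ownProb ν (Set.Iic (-1)) (shiftBy m x)) :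
    pastInv ν n x = ENNReal.ofReal (pastBlockProb ν n x)⁻¹ := by
  rw [pastInv, pastBlockProb, ← Finset.prod_inv_distrib,
    ENNReal.ofReal_prod_of_nonneg fun i _ => inv_nonneg.2 (hx _).le]
  exact Finset.prod_congr rfl fun i _ => (ENNReal.ofReal_inv_of_pos (hx _)).symm

lemma measurable_pastInv_sigmaGen (n : ℕ) :
    Measurable[sigmaGen (coord A) (Set.Iic (n : ℤ))] (pastInv ν n) := by
  refine Finset.measurable_fun_prod _ fun i hi => ?_
  have hi' := Finset.mem_range.1 hi
  have h1 : Measurable[sigmaGen (coord A) (Set.Iic 0)] (ownProb ν (Set.Iic (-1))) :=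
    measurable_ownProb _ (Set.Iic_subset_Iic.2 (by norm_num)) (by simp)
  have h2 : Measurable[sigmaGen (coord A) (Set.Iic (n : ℤ)), sigmaGen (coord A) (Set.Iic 0)]
      (shiftBy ((i : ℤ) + 1)) := measurable_shiftBy_sigmaGen fun k hk => by
    have : k ≤ 0 := hk
    simp only [Set.mem_Iic]
    omega
  exact (h1.comp h2).ennreal_ofReal.inv

lemma measurable_pastInv (n : ℕ) : Measurable (pastInv ν n) :=
  (measurable_pastInv_sigmaGen n).mono (sigmaGen_coord_le _) le_rfl

/-- Induction on the word: shifting time n + 1 to the origin makes the last letter the present and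
everything else part of the past, so its factor 1/p is absorbed by
`setLIntegral_mul_inv_condProb_le`. -/
lemma setLIntegral_mul_pastInv_le (hν : MeasurePreserving shift ν ν) {h : (ℤ → A) → ℝ≥0∞}
    (hh : Measurable[sigmaGen (coord A) (Set.Iic 0)] h) (n : ℕ) (z : Fin n → A) :
    ∫⁻ x in {x | block x 0 n = z}, h x * pastInv ν n x ∂ν ≤ ∫⁻ x, h x ∂ν := by
  induction n with
  | zero =>
    refine (setLIntegral_le_lintegral _ _).trans ?_
    simp [pastInv]
  | succ n ih =>
    set a := z (Fin.last n)
    set B : Set (ℤ → A) := {x | block x 0 n = Fin.init z}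
    have hBm : MeasurableSet[sigmaGen (coord A) (Set.Iic (n : ℤ))] B :=
      measurable_block_sigmaGen (fun k hk => by
        have := hk.2
        simp only [Set.mem_Iic]
        omega) (measurableSet_singleton _)
    set H : (ℤ → A) → ℝ≥0∞ := B.indicator fun x => h x * pastInv ν n x
    have hHm : Measurable[sigmaGen (coord A) (Set.Iic (n : ℤ))] H :=
      ((hh.mono (sigmaGen_mono _ (Set.Iic_subset_Iic.2 (by omega))) le_rfl).mul
        (measurable_pastInv_sigmaGen n)).indicator hBm
    set K : (ℤ → A) → ℝ≥0∞ := fun y => H (shiftBy (-(n + 1 : ℤ)) y)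
    have hKm : Measurable[sigmaGen (coord A) (Set.Iic (-1))] K :=
      hHm.comp (measurable_shiftBy_sigmaGen fun k hk => by
        have : k ≤ (n : ℤ) := hk
        simp only [Set.mem_Iic]
        omega)
    have hHm' : Measurable H := hHm.mono (sigmaGen_coord_le _) le_rfl
    have hpm : Measurable fun y => (ENNReal.ofReal (pastProb ν (Set.Iic (-1)) a y))⁻¹ :=
      (measurable_pastProb _ a).ennreal_ofReal.inv
    set F : (ℤ → A) → ℝ≥0∞ := (coord A 0 ⁻¹' {a}).indicator
      fun y => K y * (ENNReal.ofReal (pastProb ν (Set.Iic (-1)) a y))⁻¹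
    have hFm : Measurable F :=
      ((hKm.mono (sigmaGen_coord_le _) le_rfl).mul hpm).indicator (measurableSet_coord_eq a)
    have hset : MeasurableSet {x : ℤ → A | block x 0 (n + 1) = z} :=
      measurable_block 0 (n + 1) (measurableSet_singleton z)
    calc ∫⁻ x in {x | block x 0 (n + 1) = z}, h x * pastInv ν (n + 1) x ∂ν
        = ∫⁻ x, F (shiftBy (n + 1) x) ∂ν := by
          rw [← lintegral_indicator hset]
          refine lintegral_congr fun x => ?_
          have hmem : x ∈ {x : ℤ → A | block x 0 (n + 1) = z} ↔ x ∈ B ∧ x (n + 1) = a := by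
            simp only [Set.mem_ofPred_eq, B, a]
            rw [block_succ, ← Fin.snoc_init_self z, Fin.snoc_inj]
            simp [add_comm]
          have hK : K (shiftBy (n + 1) x) = H x := by
            simp [K, shiftBy_shiftBy]
          by_cases hxa : x (n + 1) = a
          · have h0 : shiftBy (n + 1 : ℤ) x ∈ coord A 0 ⁻¹' {a} := by
              simp [coord, shiftBy, hxa]
            simp only [F]
            rw [Set.indicator_of_mem h0, hK]
            by_cases hxB : x ∈ B
            · rw [Set.indicator_of_mem (hmem.2 ⟨hxB, hxa⟩)]
              simp only [H]
              rw [Set.indicator_of_mem hxB, pastInv, Finset.prod_range_succ, ← mul_assoc]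
              have : ownProb ν (Set.Iic (-1)) (shiftBy (n + 1 : ℤ) x)
                  = pastProb ν (Set.Iic (-1)) a (shiftBy (n + 1 : ℤ) x) := by
                have h00 : shiftBy (n + 1 : ℤ) x 0 = a := h0
                rw [ownProb, h00]
              rw [this]
              rfl
            · rw [Set.indicator_of_notMem fun hx => hxB (hmem.1 hx).1]
              simp only [H]
              rw [Set.indicator_of_notMem hxB, zero_mul]
          · have h0 : shiftBy (n + 1 : ℤ) x ∉ coord A 0 ⁻¹' {a} := by
              simp [coord, shiftBy, hxa]
            simp only [F]
            rw [Set.indicator_of_notMem h0, Set.indicator_of_notMem fun hx => hxa (hmem.1 hx).2]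
      _ = ∫⁻ y, F y ∂ν := lintegral_shiftBy hν _ hFm
      _ = ∫⁻ y in coord A 0 ⁻¹' {a}, K y * (ENNReal.ofReal (pastProb ν (Set.Iic (-1)) a y))⁻¹ ∂ν :=
          lintegral_indicator (measurableSet_coord_eq a) _
      _ ≤ ∫⁻ y, K y ∂ν :=
          setLIntegral_mul_inv_condProb_le (sigmaGen_coord_le _) (measurableSet_coord_eq a) hKm
      _ = ∫⁻ x, H x ∂ν := lintegral_shiftBy hν _ hHm'
      _ = ∫⁻ x in B, h x * pastInv ν n x ∂ν :=
          lintegral_indicator (sigmaGen_coord_le _ _ hBm) _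
      _ ≤ ∫⁻ x, h x ∂ν := ih _

lemma lintegral_eq_sum_block (n : ℕ) (f : (ℤ → A) → ℝ≥0∞) :
    ∫⁻ x, f x ∂ν = ∑ z : Fin n → A, ∫⁻ x in {x | block x 0 n = z}, f x ∂ν := by
  rw [← lintegral_biUnion_finset (s := Finset.univ)
    (t := fun z : Fin n → A => {x : ℤ → A | block x 0 n = z}) ?_
    fun z _ => measurable_block 0 n (measurableSet_singleton z)]
  · have : ⋃ z ∈ (Finset.univ : Finset (Fin n → A)), {x : ℤ → A | block x 0 n = z} = Set.univ := by
      ext x; simp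
    rw [this, setLIntegral_univ]
  · intro a _ b _ hab
    exact Disjoint.preimage (fun x : ℤ → A => block x 0 n) (Set.disjoint_singleton.2 hab)

/-- If `W` depends only on the coordinates up to `n`, then `∫ W / P(x_1^n | x_{-∞}^0)` is bounded by
any bound, uniform in the past, on the sum of `W` over all continuations of the past. -/
lemma lintegral_mul_pastInv_le (hν : MeasurePreserving shift ν ν) {n : ℕ}
    {W : (ℤ → A) → ℝ≥0∞} (hW : Measurable W)
    (hdep : ∀ x y : ℤ → A, (∀ k : ℤ, k ≤ n → x k = y k) → W x = W y) {C : ℝ≥0∞}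
    (hC : ∀ x, ∑ z : Fin n → A, W (splice x n z) ≤ C) :
    ∫⁻ x, W x * pastInv ν n x ∂ν ≤ C := by
  have hz : ∀ z : Fin n → A, Measurable[sigmaGen (coord A) (Set.Iic 0)] fun x => W (splice x n z) :=
    fun z => hW.comp (measurable_splice n z)
  calc ∫⁻ x, W x * pastInv ν n x ∂ν
      = ∑ z : Fin n → A, ∫⁻ x in {x | block x 0 n = z}, W x * pastInv ν n x ∂ν :=
        lintegral_eq_sum_block n _
    _ = ∑ z : Fin n → A, ∫⁻ x in {x | block x 0 n = z}, W (splice x n z) * pastInv ν n x ∂ν := by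
        refine Finset.sum_congr rfl fun z _ => setLIntegral_congr_fun
          (measurable_block 0 n (measurableSet_singleton z)) fun x hx => ?_
        have hxz : block x 0 n = z := hx
        rw [hdep x (splice x n z) fun k hk => by rw [← hxz, splice_block x n hk]]
    _ ≤ ∑ z : Fin n → A, ∫⁻ x, W (splice x n z) ∂ν :=
        Finset.sum_le_sum fun z _ => setLIntegral_mul_pastInv_le hν (hz z) n z
    _ = ∫⁻ x, ∑ z : Fin n → A, W (splice x n z) ∂ν :=
        (lintegral_finsetSum _ fun z _ => (hz z).mono (sigmaGen_coord_le _) le_rfl).symm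
    _ ≤ ∫⁻ _, C ∂ν := lintegral_mono hC
    _ = C := by simp

end Past

/-! ### Borel–Cantelli for integrals of linear growth -/

section BorelCantelli

/-- A sequence of nonnegative functions with integrals of at most linear growth is eventually
dominated by `(n + 1) ^ 3`. -/
lemma ae_eventually_lt_of_lintegral_le {α : Type*} [MeasurableSpace α] {ν : Measure α}
    {F : ℕ → α → ℝ≥0∞} (hF : ∀ n, AEMeasurable (F n) ν) {C : ℝ}
    (hC : ∀ n, ∫⁻ x, F n x ∂ν ≤ ENNReal.ofReal (C * (n + 1))) :
    ∀ᵐ x ∂ν, ∀ᶠ n : ℕ in atTop, F n x < ENNReal.ofReal (((n : ℝ) + 1) ^ 3) := by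
  -- Markov's inequality; the exponent 3 beats the linear growth by a summable square.
  have hle : ∀ n : ℕ, ν {x | ENNReal.ofReal (((n : ℝ) + 1) ^ 3) ≤ F n x} ≤
      ENNReal.ofReal (C * (1 / ((n : ℝ) + 1) ^ 2)) := fun n => by
    have hpos : (0 : ℝ) < ((n : ℝ) + 1) ^ 3 := by positivity
    have h1 := meas_ge_le_lintegral_div (hF n) (ENNReal.ofReal_pos.2 hpos).ne'
      ENNReal.ofReal_ne_top
    refine h1.trans ((ENNReal.div_le_div_right (hC n) _).trans ?_)
    rw [← ENNReal.ofReal_div_of_pos hpos]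
    apply le_of_eq
    congr 1
    field_simp
  have hsum : Summable fun n : ℕ => C * (1 / ((n : ℝ) + 1) ^ 2) := by
    refine Summable.mul_left C ?_
    have := (summable_nat_add_iff 1).2 (Real.summable_one_div_nat_pow.2 one_lt_two)
    simpa using this
  have hne : ∑' n : ℕ, ν {x | ENNReal.ofReal (((n : ℝ) + 1) ^ 3) ≤ F n x} ≠ ∞ :=
    ne_top_of_le_ne_top hsum.tsum_ofReal_ne_top (ENNReal.tsum_le_tsum hle)
  filter_upwards [ae_eventually_notMem hne] with x hx
  filter_upwards [hx] with n hn
  exact not_le.1 hn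

end BorelCantelli

/-! ### The Shannon–McMillan–Breiman theorem -/

section Markov

variable {A : Type*} [MeasurableSpace A]

/-- The probability of a word of length `k + n` under the `k`-th order Markov approximation. -/
noncomputable def markovProb (ν : Measure (ℤ → A)) (k : ℕ) : (n : ℕ) → (Fin (k + n) → A) → ℝ
  | 0, w => wordProb ν k w
  | n + 1, w => markovProb ν k n (fun i => w i.castSucc) *
      transProb ν k (fun j : Fin k => w ⟨n + j, by omega⟩) (w (Fin.last (k + n)))

variable {ν : Measure (ℤ → A)}

lemma markovProb_nonneg (k n : ℕ) (w : Fin (k + n) → A) : 0 ≤ markovProb ν k n w := by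
  induction n with
  | zero => exact wordProb_nonneg _ _
  | succ n ih => exact mul_nonneg (ih _) (transProb_nonneg _ _ _)

lemma markovProb_block (k n : ℕ) (x : ℤ → A) :
    markovProb ν k n (block x 0 (k + n)) = blockProb ν k x *
      ∏ i ∈ Finset.range n, stepProb ν k (shiftBy (i + (k + 1)) x) := by
  induction n with
  | zero => simp [markovProb, blockProb]
  | succ n ih =>
    rw [Finset.prod_range_succ, ← mul_assoc, ← ih, stepProb, block_shiftBy]
    have h : -(k : ℤ) - 1 + (n + (k + 1)) = n := by ring
    rw [h]
    change markovProb ν k n (block x 0 (k + n)) * transProb ν k _ _ = _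
    congr 2
    · funext j
      simp only [block]
      congr 1
      push_cast
      ring
    · simp only [block, shiftBy]
      congr 1
      simp
      ring

variable [Fintype A] [MeasurableSingletonClass A] [IsProbabilityMeasure ν]

/-- Summing out the last letter first reduces to the sub-stochastic transition probabilities. -/
lemma sum_markovProb_le (k n : ℕ) : ∑ w, markovProb ν k n w ≤ 1 := by
  induction n with
  | zero => exact (sum_wordProb k).le
  | succ n ih =>
    have h1 := (Fin.snocEquiv (fun _ : Fin (k + n + 1) => A)).sum_comp
      (fun w : Fin (k + n + 1) → A => markovProb ν k (n + 1) w)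
    change ∑ w : Fin (k + n + 1) → A, markovProb ν k (n + 1) w ≤ 1
    rw [← h1, Fintype.sum_prod_type_right]
    refine le_trans (Finset.sum_le_sum fun u _ => ?_) ih
    have h2 : ∀ a : A, markovProb ν k (n + 1) (Fin.snocEquiv (fun _ : Fin (k + n + 1) => A) (a, u))
        = markovProb ν k n u *
          transProb ν k (fun j : Fin k => u ⟨n + j, by omega⟩) a := by
      intro a
      simp only [markovProb, Fin.snocEquiv_apply, Fin.snoc_castSucc, Fin.snoc_last]
      congr 2
      funext j
      exact Fin.snoc_castSucc (α := fun _ => A) a u ⟨n + j, by omega⟩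
    simp only [h2]
    rw [← Finset.mul_sum]
    exact mul_le_of_le_one_right (markovProb_nonneg _ _ _) (sum_transProb_le _ _)

/-- The mean of a likelihood ratio is the mass of Q on words of positive probability. -/
lemma lintegral_div_blockProb_le (N : ℕ) {Q : (Fin N → A) → ℝ} (hQ : ∀ w, 0 ≤ Q w) :
    ∫⁻ x, ENNReal.ofReal (Q (block x 0 N) / blockProb ν N x) ∂ν ≤ ENNReal.ofReal (∑ w, Q w) := by
  have h := lintegral_map (μ := ν) (f := fun w => ENNReal.ofReal (Q w / wordProb ν N w))
    (measurable_of_finite _) (measurable_block (A := A) 0 N)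
  simp only [blockProb]
  rw [← h, lintegral_fintype, ENNReal.ofReal_sum_of_nonneg fun w _ => hQ w]
  refine Finset.sum_le_sum fun w _ => ?_
  have h2 : (ν.map fun x => block x 0 N) {w} = ENNReal.ofReal (wordProb ν N w) := by
    rw [Measure.map_apply (measurable_block 0 N) (measurableSet_singleton w), wordProb,
      ofReal_measureReal]
    rfl
  rw [h2, ← ENNReal.ofReal_mul' (wordProb_nonneg _ _)]
  refine ENNReal.ofReal_le_ofReal ?_
  rcases eq_or_ne (wordProb ν N w) 0 with h0 | h0
  · simp [h0, hQ w]
  · rw [div_mul_cancel₀ _ h0]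

lemma ae_eventually_log_markovProb_sub_le (k : ℕ) (hν : MeasurePreserving shift ν ν) :
    ∀ᵐ x ∂ν, ∀ᶠ n : ℕ in atTop, 0 < markovProb ν k n (block x 0 (k + n)) →
      Real.log (markovProb ν k n (block x 0 (k + n))) - Real.log (blockProb ν (k + n) x) ≤
        3 * Real.log (n + 1) := by
  have h := ae_eventually_lt_of_lintegral_le (ν := ν) (C := 1)
    (F := fun n x => ENNReal.ofReal (markovProb ν k n (block x 0 (k + n)) / blockProb ν (k + n) x))
    (fun n => ?_) (fun n => ?_)
  · filter_upwards [h, ae_blockProb_pos hν] with x hx hpos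
    filter_upwards [hx] with n hn hQ
    have h3 := (ENNReal.ofReal_lt_ofReal_iff (by positivity)).1 hn
    rw [← Real.log_div hQ.ne' (hpos _).ne']
    have := Real.log_le_log (div_pos hQ (hpos _)) h3.le
    rwa [Real.log_pow] at this
  · exact ((((measurable_of_finite (markovProb ν k n)).comp (measurable_block 0 (k + n))).div
      (measurable_blockProb (k + n))).ennreal_ofReal).aemeasurable
  · refine (lintegral_div_blockProb_le (k + n) (markovProb_nonneg k n)).trans
      (ENNReal.ofReal_le_ofReal ((sum_markovProb_le k n).trans ?_))
    have : (0 : ℝ) ≤ n := n.cast_nonneg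
    linarith

/-- The likelihood ratio argument under the conditional law given the past: P(x_1^n) sums to 1 over
the continuations of every past. -/
lemma ae_eventually_log_blockProb_sub_le (hν : MeasurePreserving shift ν ν) :
    ∀ᵐ x ∂ν, ∀ᶠ n : ℕ in atTop,
      Real.log (blockProb ν n x) - Real.log (pastBlockProb ν n x) ≤ 3 * Real.log (n + 1) := by
  have h := ae_eventually_lt_of_lintegral_le (ν := ν) (C := 1)
    (F := fun n x => ENNReal.ofReal (blockProb ν n x) * pastInv ν n x)
    (fun n => ((measurable_blockProb n).ennreal_ofReal.mul (measurable_pastInv n)).aemeasurable)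
    (fun n => ?_)
  · filter_upwards [h, ae_blockProb_pos hν, pastBlockProb_pos hν,
      ae_shiftBy hν (ownProb_pos (ν := ν) (Set.Iic (-1)))] with x hx hpos hG hown
    filter_upwards [hx] with n hn
    rw [pastInv_eq hown, ← ENNReal.ofReal_mul (hpos n).le, ← div_eq_mul_inv] at hn
    have h3 := (ENNReal.ofReal_lt_ofReal_iff (by positivity)).1 hn
    rw [← Real.log_div (hpos n).ne' (hG n).ne']
    have := Real.log_le_log (div_pos (hpos n) (hG n)) h3.le
    rwa [Real.log_pow] at this
  · refine (lintegral_mul_pastInv_le hν (measurable_blockProb n).ennreal_ofReal ?_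
      (C := 1) fun x => ?_).trans ?_
    · intro x y hxy
      rw [blockProb, blockProb, block_congr fun k _ hk => hxy k (by omega)]
    · simp only [blockProb, block_splice]
      rw [← ENNReal.ofReal_sum_of_nonneg fun w _ => wordProb_nonneg _ _, sum_wordProb]
      simp
    · rw [← ENNReal.ofReal_one]
      refine ENNReal.ofReal_le_ofReal ?_
      have : (0 : ℝ) ≤ n := n.cast_nonneg
      linarith

end Markov

/-! ### Logarithmic error terms against linear growth -/

lemma tendsto_log_succ_div : Tendsto (fun n : ℕ => Real.log (n + 1) / n) atTop (𝓝 0) := by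
  have h1 : (fun x : ℝ => Real.log (x + 1)) =o[atTop] fun x : ℝ => x := by
    have h := (Real.isLittleO_log_id_atTop).comp_tendsto (tendsto_atTop_add_const_right atTop (1 : ℝ)
      tendsto_id)
    refine h.trans_isBigO ?_
    refine IsBigO.of_bound 2 ?_
    filter_upwards [eventually_ge_atTop (1 : ℝ)] with x hx
    simp only [Function.comp, id]
    rw [Real.norm_of_nonneg (by linarith), Real.norm_of_nonneg (by linarith)]
    linarith
  exact (h1.tendsto_div_nhds_zero).comp tendsto_natCast_atTop_atTop

lemma eventually_linear_add_log_le {a b : ℝ} (hab : a < b) (c : ℝ) :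
    ∀ᶠ n : ℕ in atTop, a * n + c + 3 * Real.log (n + 1) ≤ b * n := by
  have h1 : Tendsto (fun n : ℕ => c / n + 3 * (Real.log (n + 1) / n)) atTop (𝓝 (0 + 3 * 0)) :=
    (tendsto_const_div_atTop_nhds_zero_nat c).add (tendsto_log_succ_div.const_mul 3)
  have h2 := h1.eventually (gt_mem_nhds (show (0 : ℝ) + 3 * 0 < b - a by simpa using hab))
  filter_upwards [h2, eventually_gt_atTop 0] with n hn hn0
  have hn0' : (0 : ℝ) < n := Nat.cast_pos.2 hn0
  have h3 : (c / n + 3 * (Real.log (n + 1) / n)) * n = c + 3 * Real.log (n + 1) := by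
    field_simp
  have h4 := mul_lt_mul_of_pos_right hn hn0'
  rw [h3] at h4
  linarith

section SMB

variable {A : Type*} [MeasurableSpace A] [Fintype A] [MeasurableSingletonClass A]
  {ν : Measure (ℤ → A)} [IsProbabilityMeasure ν]

/-- The entropy rate, in nats. -/
noncomputable def entropyRate (ν : Measure (ℤ → A)) : ℝ := entropyGiven ν (Set.Iic (-1))

lemma wordProb_block_add_le (k n : ℕ) (x : ℤ → A) :
    blockProb ν (k + n) x ≤ blockProb ν n x := by
  refine measureReal_mono (fun y hy => ?_)
  have hy' : block y 0 (k + n) = block x 0 (k + n) := hy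
  change block y 0 n = block x 0 n
  refine block_congr fun j h1 h2 => ?_
  have h3 : j ≤ 0 + ((k + n : ℕ) : ℤ) := by push_cast; omega
  rw [block_apply_of_mem y h1 h3, block_apply_of_mem x h1 h3, hy']

/-- P(x_1^n) is, up to a polynomial factor, no smaller than its Markov approximation of order k,
whose negative logarithm is a Birkhoff sum up to a constant. Its mean is below the entropy rate plus
ε/2 for suitable k. -/
lemma ae_eventually_neg_log_blockProb_le (hν : Ergodic shift ν) {ε : ℝ} (hε : 0 < ε) :
    ∀ᵐ x ∂ν, ∀ᶠ n : ℕ in atTop, -Real.log (blockProb ν n x) ≤ (entropyRate ν + ε) * n := by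
  have hmp := hν.toMeasurePreserving
  obtain ⟨k, hk⟩ := ((tendsto_entropyGiven (ν := ν)).eventually
    (gt_mem_nhds (show entropyRate ν < entropyRate ν + ε / 2 by linarith))).exists
  set f : (ℤ → A) → ℝ := fun x => -Real.log (stepProb ν k x)
  have hfae : (fun x => -Real.log (ownProb ν (Set.Icc (-(k : ℤ)) (-1)) x)) =ᵐ[ν] f := by
    filter_upwards [stepProb_ae_eq_ownProb hmp k] with x hx
    simp only [f, hx]
  have hfi : Integrable f ν := (integrable_neg_log_ownProb _).congr hfae
  have hfm : Measurable f := (Real.measurable_log.comp (measurable_stepProb k)).neg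
  have hfint : ∫ x, f x ∂ν < entropyRate ν + ε / 2 := by
    rw [← integral_congr_ae hfae]
    exact hk
  filter_upwards [ae_shiftBy hmp (ae_exists_birkhoffSum_le hν hfm hfi hfint),
    ae_eventually_log_markovProb_sub_le k hmp, ae_wordProb_pos hmp] with x hx hQ hpos
  obtain ⟨K, hK⟩ := hx (k + 1)
  have hstep : ∀ i : ℕ, 0 < stepProb ν k (shiftBy (i + (k + 1)) x) := fun i => by
    have := stepProb_eq_div (ν := ν) x k i
    rw [show (i : ℤ) + (k + 1) = i + 1 + k by ring, this]
    exact div_pos (hpos _ _) (hpos _ _)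
  filter_upwards [hQ, eventually_linear_add_log_le
    (show entropyRate ν + ε / 2 < entropyRate ν + ε by linarith)
    (K - Real.log (blockProb ν k x))] with n hn hlin
  have hprodpos : 0 < ∏ i ∈ Finset.range n, stepProb ν k (shiftBy (i + (k + 1)) x) :=
    Finset.prod_pos fun i _ => hstep i
  rw [markovProb_block] at hn
  have h1 := hn (mul_pos (hpos 0 k) hprodpos)
  have hk0 : 0 < blockProb ν k x := hpos 0 k
  rw [Real.log_mul hk0.ne' hprodpos.ne', Real.log_prod fun i _ => (hstep i).ne'] at h1
  have h2 : birkhoffSum shift f n (shiftBy (k + 1) x)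
      = -∑ i ∈ Finset.range n, Real.log (stepProb ν k (shiftBy (i + (k + 1)) x)) := by
    rw [birkhoffSum, ← Finset.sum_neg_distrib]
    refine Finset.sum_congr rfl fun i _ => ?_
    rw [shift_iterate, shiftBy_shiftBy]
  have h3 := hK n
  -- The Markov comparison has length k + n; a shorter block is at least as probable.
  have h4 := Real.log_le_log (hpos 0 (k + n)) (wordProb_block_add_le (ν := ν) k n x)
  change Real.log (blockProb ν (k + n) x) ≤ _ at h4
  linarith

/-- Given the infinite past, the log-probability is exactly a Birkhoff sum, with mean minus the
entropy rate. The logarithmic term is carried along for the later comparisons. -/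
lemma ae_eventually_log_pastBlockProb_le (hν : Ergodic shift ν) {ε : ℝ} (hε : 0 < ε) :
    ∀ᵐ x ∂ν, ∀ᶠ n : ℕ in atTop,
      Real.log (pastBlockProb ν n x) + 3 * Real.log (n + 1) ≤ (-entropyRate ν + ε) * n := by
  have hmp := hν.toMeasurePreserving
  set f : (ℤ → A) → ℝ := fun x => Real.log (ownProb ν (Set.Iic (-1)) x)
  have hfi : Integrable f ν := by
    simpa [f] using (integrable_neg_log_ownProb (ν := ν) (Set.Iic (-1))).neg
  have hfm : Measurable f := Real.measurable_log.comp (measurable_ownProb' _)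
  have hfint : ∫ x, f x ∂ν < -entropyRate ν + ε / 2 := by
    rw [entropyRate, entropyGiven, integral_neg]
    simp only [f]
    linarith
  filter_upwards [ae_shiftBy hmp (ae_exists_birkhoffSum_le hν hfm hfi hfint),
    ae_shiftBy hmp (ownProb_pos (ν := ν) (Set.Iic (-1)))] with x hx hpos
  obtain ⟨K, hK⟩ := hx 1
  filter_upwards [eventually_linear_add_log_le
    (show -entropyRate ν + ε / 2 < -entropyRate ν + ε by linarith) K] with n hlin
  have h1 : Real.log (pastBlockProb ν n x) = birkhoffSum shift f n (shiftBy 1 x) := by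
    rw [pastBlockProb, Real.log_prod fun i _ => (hpos _).ne', birkhoffSum]
    refine Finset.sum_congr rfl fun i _ => ?_
    rw [shift_iterate, shiftBy_shiftBy]
  linarith [hK n]

/-- The Shannon–McMillan–Breiman theorem. -/
theorem tendsto_neg_log_blockProb_div (hν : Ergodic shift ν) :
    ∀ᵐ x ∂ν, Tendsto (fun n : ℕ => -Real.log (blockProb ν n x) / n) atTop
      (𝓝 (entropyRate ν)) := by
  have h1 := ae_all_iff.2 fun m : ℕ => ae_eventually_neg_log_blockProb_le hν
    (show (0 : ℝ) < 1 / (m + 1) by positivity)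
  have h2 := ae_all_iff.2 fun m : ℕ => ae_eventually_log_pastBlockProb_le hν
    (show (0 : ℝ) < 1 / (m + 1) by positivity)
  filter_upwards [h1, h2, ae_eventually_log_blockProb_sub_le hν.toMeasurePreserving]
    with x hx1 hx2 hx3
  rw [Metric.tendsto_nhds]
  intro ε hε
  obtain ⟨m, hm⟩ := exists_nat_one_div_lt hε
  filter_upwards [hx1 m, hx2 m, hx3, eventually_gt_atTop 0] with n hn1 hn2 hn3 hn0
  have hn0' : (0 : ℝ) < n := Nat.cast_pos.2 hn0
  rw [Real.dist_eq]
  refine lt_of_le_of_lt ?_ hm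
  rw [abs_le]
  constructor
  · rw [neg_le_sub_iff_le_add, ← sub_le_iff_le_add, le_div_iff₀ hn0']
    linarith
  · rw [sub_le_iff_le_add, div_le_iff₀ hn0']
    linarith

/-- The gap G_n needs only an upper bound; the two one-sided bounds, with ε/2 each, cancel the
entropy rate. -/
lemma ae_eventually_log_pastBlockProb_sub_le (hν : Ergodic shift ν) {ε : ℝ} (hε : 0 < ε) :
    ∀ᵐ x ∂ν, ∀ᶠ n : ℕ in atTop,
      Real.log (pastBlockProb ν n x) + 3 * Real.log (n + 1) - Real.log (blockProb ν n x) ≤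
        ε * n := by
  filter_upwards [ae_eventually_neg_log_blockProb_le hν (half_pos hε),
    ae_eventually_log_pastBlockProb_le hν (half_pos hε)] with x h1 h2
  filter_upwards [h1, h2] with n hn1 hn2
  linarith

end SMB

/-! ### Recurrence times -/

section RecTime

variable {A B : Type*}

lemma biInf_natCast_eq {S : Set ℕ} (hS : S.Nonempty) :
    ⨅ i ∈ S, (i : ℕ∞) = ((sInf S : ℕ) : ℕ∞) :=
  le_antisymm (iInf₂_le (sInf S) (Nat.sInf_mem hS))
    (le_iInf₂ fun _ hi => Nat.cast_le.2 (Nat.sInf_le hi))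

lemma exists_mem_of_biInf_natCast {S : Set ℕ} {j : ℕ} (h : ⨅ i ∈ S, (i : ℕ∞) = j) : j ∈ S := by
  rcases S.eq_empty_or_nonempty with rfl | hS
  · simp at h
  · rw [biInf_natCast_eq hS, Nat.cast_inj] at h
    rw [← h]
    exact Nat.sInf_mem hS

/-- Since i = 0 always matches, it is both R_n^{(0)} and the zeroth term of `Nat.nth`, so no index
shift occurs. -/
lemma recTime_eq_nth (y : ℤ → A) (n : ℕ)
    (hinf : {i : ℕ | block y (-(i : ℤ)) n = block y 0 n}.Infinite) (j : ℕ) :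
    recTime y n j = (Nat.nth (fun i : ℕ => block y (-(i : ℤ)) n = block y 0 n) j : ℕ∞) := by
  classical
  set p : ℕ → Prop := fun i : ℕ => block y (-(i : ℤ)) n = block y 0 n
  have hp : (Set.ofPred p).Infinite := hinf
  induction j with
  | zero => simp [recTime, Nat.nth_zero_of_zero (show p 0 by simp [p])]
  | succ j ih =>
    rw [recTime]
    have hlt : recTime y n j < (Nat.nth p (j + 1) : ℕ∞) := by
      rw [ih]
      exact Nat.cast_lt.2 (Nat.nth_strictMono hp (Nat.lt_succ_self j))
    refine le_antisymm (iInf₂_le _ ⟨hlt, Nat.nth_mem_of_infinite hp _⟩) (le_iInf₂ fun i hi => ?_)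
    · obtain ⟨h1, h2⟩ := hi
      rw [ih, Nat.cast_lt] at h1
      have h3 : Nat.nth p (Nat.count p i) = i := Nat.nth_count (p := p) h2
      rw [← h3] at h1 ⊢
      exact Nat.cast_le.2 ((Nat.nth_monotone hp) ((Nat.nth_lt_nth hp).1 h1))

lemma one_le_condRecTime (x : ℤ → A) (y : ℤ → B) (n : ℕ) : 1 ≤ condRecTime x y n :=
  le_iInf₂ fun i hi => by exact_mod_cast hi.1

/-- The count over i < τ includes the trivial match i = 0, and is therefore exactly the index of τ
among the recurrence times of y_1^n. -/
lemma condRecTime_le_count {x : ℤ → A} {y : ℤ → B} {n : ℕ}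
    [DecidablePred fun i : ℕ => block y (-(i : ℤ)) n = block y 0 n]
    (hinf : {i : ℕ | block y (-(i : ℤ)) n = block y 0 n}.Infinite) {τ : ℕ} (hτ : 0 < τ)
    (hx : block x (-(τ : ℤ)) n = block x 0 n) (hy : block y (-(τ : ℤ)) n = block y 0 n) :
    condRecTime x y n ≤ Nat.count (fun i : ℕ => block y (-(i : ℤ)) n = block y 0 n) τ := by
  refine iInf₂_le _ ⟨?_, τ, ?_, hx⟩
  · refine Nat.pos_of_ne_zero fun h => ?_
    exact Nat.count_iff_forall_not.1 h 0 hτ (by simp)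
  · rw [recTime_eq_nth y n hinf,
      Nat.nth_count (p := fun i : ℕ => block y (-(i : ℤ)) n = block y 0 n) hy]

lemma recTime_congr {y y' : ℤ → A} {n : ℕ} (h : ∀ k : ℤ, k ≤ n → y k = y' k) (j : ℕ) :
    recTime y n j = recTime y' n j := by
  have hb : ∀ i : ℕ, block y (-(i : ℤ)) n = block y' (-(i : ℤ)) n := fun i =>
    block_congr fun k _ hk => h k (by omega)
  have h0 : block y 0 n = block y' 0 n := by simpa using hb 0
  induction j with
  | zero => rfl
  | succ j ih => simp only [recTime, ih, hb, h0]

lemma condRecTime_congr {x x' : ℤ → A} {y y' : ℤ → B} {n : ℕ} (hx : ∀ k : ℤ, k ≤ n → x k = x' k)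
    (hy : ∀ k : ℤ, k ≤ n → y k = y' k) : condRecTime x y n = condRecTime x' y' n := by
  have hb : ∀ i : ℕ, block x (-(i : ℤ)) n = block x' (-(i : ℤ)) n := fun i =>
    block_congr fun k _ hk => hx k (by omega)
  have h0 : block x 0 n = block x' 0 n := by simpa using hb 0
  simp only [condRecTime, recTime_congr hy, hb, h0]

lemma pos_of_recTime_eq {y : ℤ → B} {n j r : ℕ} (hj : 1 ≤ j) (h : recTime y n j = r) : 0 < r := by
  obtain ⟨j, rfl⟩ := Nat.exists_eq_add_of_le' hj
  have := exists_mem_of_biInf_natCast h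
  refine Nat.pos_of_ne_zero fun h0 => ?_
  rw [h0] at this
  simpa using this.1

/-- Given the past and the side information, the conditional recurrence time determines the
string `x_1^n`. -/
lemma block_eq_of_condRecTime_eq {x x' : ℤ → A} {y : ℤ → B} {n j : ℕ}
    (hpast : ∀ k : ℤ, k ≤ 0 → x k = x' k) (h : condRecTime x y n = j)
    (h' : condRecTime x' y n = j) : block x 0 n = block x' 0 n := by
  obtain ⟨hj, r, hr, hx⟩ := exists_mem_of_biInf_natCast h
  obtain ⟨-, r', hr', hx'⟩ := exists_mem_of_biInf_natCast h'
  obtain rfl : r = r' := by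
    rw [hr, Nat.cast_inj] at hr'
    exact hr'
  have hr0 := pos_of_recTime_eq hj hr
  -- Since r ≥ 1, each letter is copied from an earlier time. That time lies in the common past or,
  -- when the two blocks overlap, among the letters already determined.
  have key : ∀ m : ℕ, m < n → x (m + 1) = x' (m + 1) := by
    intro m
    induction m using Nat.strong_induction_on with
    | _ m ih =>
      intro hm
      have e1 := congrFun hx ⟨m, hm⟩
      have e2 := congrFun hx' ⟨m, hm⟩
      simp only [block] at e1 e2
      have e3 : x (-(r : ℤ) + 1 + m) = x' (-(r : ℤ) + 1 + m) := by
        rcases le_or_gt (-(r : ℤ) + 1 + m) 0 with h | h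
        · exact hpast _ h
        · have := ih (m - r) (by omega) (by omega)
          have e : ((m - r : ℕ) : ℤ) + 1 = -(r : ℤ) + 1 + m := by omega
          rwa [e] at this
      rw [show (m : ℤ) + 1 = 0 + 1 + m by ring, ← e1, ← e2, e3]
  funext k
  have := key k k.isLt
  rw [block, block, show (0 : ℤ) + 1 + (k : ℕ) = (k : ℕ) + 1 by ring]
  exact this

end RecTime

/-! ### Sums of reciprocals of distinct times -/

section Harmonic

/-- With N = |W|, the values up to N are distinct and contribute at most a harmonic sum, 1 + log N;
each larger value, possibly infinite and repeated, contributes at most 1/N, together at most 1. -/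
lemma sum_inv_le_of_injective {W : Type*} [Fintype W] (f : W → ℕ∞)
    (h1 : ∀ a, 1 ≤ f a) (hinj : ∀ a b (j : ℕ), f a = j → f b = j → a = b) :
    ∑ a, ((f a : ℝ≥0∞))⁻¹ ≤ ENNReal.ofReal (2 + Real.log (Fintype.card W)) := by
  classical
  set N := Fintype.card W
  have hle : ∀ a, ((f a : ℝ≥0∞))⁻¹ ≤
      (if f a ≤ N then (((f a).toNat : ℝ≥0∞))⁻¹ else 0) + ((N : ℝ≥0∞))⁻¹ := by
    intro a
    by_cases ha : f a ≤ N
    · obtain ⟨j, hj⟩ := ENat.ne_top_iff_exists.1 (ne_top_of_le_ne_top (ENat.natCast_ne_top N) ha)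
      rw [if_pos ha, ← hj]
      simp
    · rw [if_neg ha, zero_add, ENNReal.inv_le_inv]
      have := ENat.toENNReal_le.2 (not_le.1 ha).le
      simpa using this
  refine (Finset.sum_le_sum fun a _ => hle a).trans ?_
  rw [Finset.sum_add_distrib, Finset.sum_const, nsmul_eq_mul, Finset.card_univ]
  have hN1 : (N : ℝ≥0∞) * ((N : ℝ≥0∞))⁻¹ ≤ 1 := ENNReal.mul_inv_le_one _
  have hH : ∑ a, (if f a ≤ N then (((f a).toNat : ℝ≥0∞))⁻¹ else 0) ≤
      ENNReal.ofReal (1 + Real.log N) := by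
    rw [← Finset.sum_filter]
    have hfin : ∀ a ∈ Finset.univ.filter (fun a => f a ≤ N), ((f a).toNat : ℕ∞) = f a := by
      intro a ha
      exact ENat.natCast_toNat (ne_top_of_le_ne_top (ENat.natCast_ne_top N) (Finset.mem_filter.1 ha).2)
    have hinj' : Set.InjOn (fun a => (f a).toNat)
        (Finset.univ.filter (fun a => f a ≤ N) : Finset W) := by
      intro a ha b hb hab
      have hab' : (f a).toNat = (f b).toNat := hab
      exact hinj a b (f b).toNat (by rw [← hab', hfin a ha]) (hfin b hb).symm
    rw [← Finset.sum_image (f := fun j : ℕ => ((j : ℝ≥0∞))⁻¹) hinj']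
    have hsub : (Finset.univ.filter (fun a => f a ≤ N)).image (fun a => (f a).toNat) ⊆
        Finset.Icc 1 N := by
      intro j hj
      obtain ⟨a, ha, rfl⟩ := Finset.mem_image.1 hj
      have e := hfin a ha
      have h3 := (Finset.mem_filter.1 ha).2
      have h4 := h1 a
      rw [← e] at h3 h4
      exact Finset.mem_Icc.2 ⟨by exact_mod_cast h4, by exact_mod_cast h3⟩
    refine (Finset.sum_le_sum_of_subset hsub).trans ?_
    have h5 : ∑ j ∈ Finset.Icc 1 N, ((j : ℝ≥0∞))⁻¹ = ENNReal.ofReal (harmonic N : ℝ) := by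
      rw [harmonic_eq_sum_Icc, Rat.cast_sum, ENNReal.ofReal_sum_of_nonneg]
      · refine Finset.sum_congr rfl fun j hj => ?_
        have hj0 : 0 < (j : ℝ) := Nat.cast_pos.2 (Finset.mem_Icc.1 hj).1
        rw [Rat.cast_inv, Rat.cast_natCast, ENNReal.ofReal_inv_of_pos hj0, ENNReal.ofReal_natCast]
      · intro j _
        positivity
    rw [h5]
    exact ENNReal.ofReal_le_ofReal (harmonic_le_one_add_log N)
  refine (add_le_add hH hN1).trans ?_
  have hlog : 0 ≤ Real.log N := Real.log_natCast_nonneg N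
  rw [← ENNReal.ofReal_one, ← ENNReal.ofReal_add (by linarith) zero_le_one]
  exact ENNReal.ofReal_le_ofReal (by linarith)

end Harmonic

/-! ### The conditional recurrence time on the joint path space -/

section Joint

variable {A B : Type*}

/-- The first component of a path. -/
def fstPath (ω : ℤ → A × B) : ℤ → A := fun k => (ω k).1

/-- The second component of a path. -/
def sndPath (ω : ℤ → A × B) : ℤ → B := fun k => (ω k).2

/-- The conditional recurrence time as a function of the joint path. -/
noncomputable def jointRecTime (n : ℕ) (ω : ℤ → A × B) : ℕ∞ :=
  condRecTime (fstPath ω) (sndPath ω) n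

lemma block_fstPath (ω : ℤ → A × B) (m : ℤ) (n : ℕ) :
    block (fstPath ω) m n = fun k => (block ω m n k).1 := rfl

lemma block_sndPath (ω : ℤ → A × B) (m : ℤ) (n : ℕ) :
    block (sndPath ω) m n = fun k => (block ω m n k).2 := rfl

lemma sndPath_shiftBy (ω : ℤ → A × B) (m : ℤ) :
    sndPath (shiftBy m ω) = shiftBy m (sndPath ω) := rfl

lemma sndPath_splice (ω : ℤ → A × B) (n : ℕ) (z : Fin n → A × B) :
    sndPath (splice ω n z) = splice (sndPath ω) n fun k => (z k).2 := by
  funext k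
  simp only [sndPath, splice]
  split_ifs <;> rfl

variable [MeasurableSpace A] [MeasurableSpace B]

lemma measurable_fstPath : Measurable (fstPath : (ℤ → A × B) → (ℤ → A)) :=
  measurable_pi_lambda _ fun k => measurable_fst.comp (measurable_pi_apply k)

lemma measurable_sndPath : Measurable (sndPath : (ℤ → A × B) → (ℤ → B)) :=
  measurable_pi_lambda _ fun k => measurable_snd.comp (measurable_pi_apply k)

lemma measurable_biInf_natCast {Ω : Type*} [MeasurableSpace Ω] {S : ℕ → Set Ω}
    (hS : ∀ i, MeasurableSet (S i)) :
    Measurable fun ω => ⨅ i ∈ {i : ℕ | ω ∈ S i}, (i : ℕ∞) := by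
  classical
  have : BorelSpace ℕ∞ := ⟨borel_eq_top_of_countable.symm⟩
  refine Measurable.iInf fun i => ?_
  have : (fun ω => ⨅ (_ : i ∈ {i : ℕ | ω ∈ S i}), (i : ℕ∞)) =
      fun ω => if ω ∈ S i then (i : ℕ∞) else ⊤ := by
    funext ω
    by_cases h : ω ∈ S i <;> simp [h]
  rw [this]
  exact Measurable.ite (hS i) measurable_const measurable_const

variable [Finite A] [MeasurableSingletonClass A] [Finite B] [MeasurableSingletonClass B]

lemma measurable_recTime (n j : ℕ) : Measurable fun y : ℤ → B => recTime y n j := by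
  induction j with
  | zero => exact measurable_const
  | succ j ih =>
    simp only [recTime]
    refine measurable_biInf_natCast
      (S := fun i => {y : ℤ → B | recTime y n j < i ∧ block y (-(i : ℤ)) n = block y 0 n})
      fun i => ?_
    exact (ih (MeasurableSet.of_discrete (s := Set.Iio (i : ℕ∞)))).inter
      (measurableSet_eq_fun (measurable_block _ n) (measurable_block 0 n))

lemma measurable_jointRecTime (n : ℕ) : Measurable (jointRecTime n : (ℤ → A × B) → ℕ∞) := by
  change Measurable fun ω : ℤ → A × B => condRecTime (fstPath ω) (sndPath ω) n
  simp only [condRecTime]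
  refine measurable_biInf_natCast (S := fun i => {ω : ℤ → A × B | 1 ≤ i ∧ ∃ r : ℕ,
    recTime (sndPath ω) n i = (r : ℕ∞) ∧
      block (fstPath ω) (-(r : ℤ)) n = block (fstPath ω) 0 n}) fun i => ?_
  have h : MeasurableSet (⋃ r : ℕ, {ω : ℤ → A × B | recTime (sndPath ω) n i = (r : ℕ∞)} ∩
      {ω | block (fstPath ω) (-(r : ℤ)) n = block (fstPath ω) 0 n}) :=
    MeasurableSet.iUnion fun r =>
      (((measurable_recTime n i).comp measurable_sndPath)
        (measurableSet_singleton (r : ℕ∞))).inter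
      (measurableSet_eq_fun ((measurable_block _ n).comp measurable_fstPath)
        ((measurable_block 0 n).comp measurable_fstPath))
  convert (MeasurableSet.const (1 ≤ i)).inter h using 1
  ext ω
  simp

end Joint

/-! ### Bounds on the conditional recurrence time -/

section Bounds

variable {A B : Type*} [MeasurableSpace A] [MeasurableSpace B]
  [Fintype A] [MeasurableSingletonClass A] [Fintype B] [MeasurableSingletonClass B]
  {ν : Measure (ℤ → A × B)} [IsProbabilityMeasure ν]

/-- The conditional probability `P(x_1^n | y_1^n)` as a function of the joint path. -/
noncomputable def condBlockProb (ν : Measure (ℤ → A × B)) (n : ℕ) (ω : ℤ → A × B) : ℝ :=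
  blockProb ν n ω / blockProb (ν.map sndPath) n (sndPath ω)

lemma wordProb_map_sndPath (n : ℕ) (b : Fin n → B) :
    wordProb (ν.map sndPath) n b = ν.real {ω | block (sndPath ω) 0 n = b} := by
  rw [wordProb, map_measureReal_apply measurable_sndPath
    (s := {x | block x 0 n = b}) (measurable_block 0 n (measurableSet_singleton b))]
  rfl

lemma ergodic_map_sndPath (hν : Ergodic shift ν) : Ergodic shift (ν.map sndPath) := by
  have hmp : MeasurePreserving (sndPath : (ℤ → A × B) → _) ν (ν.map sndPath) :=
    measurable_sndPath.measurePreserving ν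
  exact hmp.ergodic_of_ergodic_semiconj hν
    (measurable_pi_lambda _ fun k => measurable_pi_apply (k + 1)) fun _ => rfl

lemma ae_blockProb_sndPath_pos (hν : Ergodic shift ν) :
    ∀ᵐ ω ∂ν, ∀ n, 0 < blockProb (ν.map sndPath) n (sndPath ω) := by
  have : IsProbabilityMeasure (ν.map sndPath) :=
    Measure.isProbabilityMeasure_map measurable_sndPath.aemeasurable
  exact ae_of_ae_map measurable_sndPath.aemeasurable
    (ae_blockProb_pos (ergodic_map_sndPath hν).toMeasurePreserving)

lemma condBlockProb_pos (hν : Ergodic shift ν) : ∀ᵐ ω ∂ν, ∀ n, 0 < condBlockProb ν n ω := by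
  filter_upwards [ae_blockProb_pos hν.toMeasurePreserving, ae_blockProb_sndPath_pos hν]
    with ω h1 h2 n
  exact div_pos (h1 n) (h2 n)

lemma measurable_condBlockProb (n : ℕ) : Measurable (condBlockProb ν n) :=
  (measurable_blockProb n).div ((measurable_blockProb n).comp measurable_sndPath)

/-- Almost surely, the initial block recurs infinitely often in the past. -/
lemma ae_infinite_recurrence {A : Type*} [MeasurableSpace A] [Fintype A]
    [MeasurableSingletonClass A] {ν : Measure (ℤ → A)} [IsProbabilityMeasure ν]
    (hν : MeasurePreserving shift ν ν) :
    ∀ᵐ ω ∂ν, ∀ n : ℕ, {i : ℕ | block ω (-(i : ℤ)) n = block ω 0 n}.Infinite := by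
  -- Poincaré recurrence for the backward shift.
  have hcons := (measurePreserving_shiftBy hν (-1)).conservative
  have hiter : ∀ (i : ℕ) (ω : ℤ → A), (shiftBy (-1))^[i] ω = shiftBy (-(i : ℤ)) ω := by
    intro i
    induction i with
    | zero => simp
    | succ i ih =>
      intro ω
      rw [Function.iterate_succ_apply, ih, shiftBy_shiftBy]
      congr 1
      push_cast
      ring
  refine ae_all_iff.2 fun n => ?_
  have h : ∀ᵐ ω ∂ν, ∀ z : Fin n → A, ω ∈ {ω : ℤ → A | block ω 0 n = z} →
      ∃ᶠ i in atTop, (shiftBy (-1))^[i] ω ∈ {ω : ℤ → A | block ω 0 n = z} :=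
    ae_all_iff.2 fun z => hcons.ae_mem_imp_frequently_image_mem
      (measurable_block 0 n (measurableSet_singleton z)).nullMeasurableSet
  filter_upwards [h] with ω hω
  have := Nat.frequently_atTop_iff_infinite.1 (hω _ rfl)
  refine this.mono fun i hi => ?_
  have hi' : block ((shiftBy (-1))^[i] ω) 0 n = block ω 0 n := hi
  rw [hiter, block_shiftBy, zero_add] at hi'
  exact hi'

/-- A conditional version of Kac's lemma (an inequality). -/
lemma setLIntegral_jointRecTime_le (hν : MeasurePreserving shift ν ν) (n : ℕ)
    (z : Fin n → A × B) :
    ∫⁻ ω in {ω | block ω 0 n = z}, (jointRecTime n ω : ℝ≥0∞) ∂ν ≤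
      ν {ω | block (sndPath ω) 0 n = fun k => (z k).2} := by
  classical
  set E : Set (ℤ → A × B) := {ω | block ω 0 n = z}
  set C : Set (ℤ → A × B) := {ω | block (sndPath ω) 0 n = fun k => (z k).2}
  have hE : MeasurableSet E := measurable_block 0 n (measurableSet_singleton z)
  have hC : MeasurableSet C :=
    ((measurable_block 0 n).comp measurable_sndPath) (measurableSet_singleton _)
  -- The word y_1^n occurs now and the joint word z occurs for the first time k steps later; the
  -- first occurrence makes these events disjoint.
  set D : ℕ → Set (ℤ → A × B) := fun k =>
    {ω | ω ∈ C ∧ shiftBy (k : ℤ) ω ∈ E ∧ ∀ j : ℕ, j < k → shiftBy (j : ℤ) ω ∉ E}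
  have hD : ∀ k, MeasurableSet (D k) := fun k => by
    have h1 : MeasurableSet (⋂ j : ℕ, ⋂ (_ : j < k),
        (shiftBy (j : ℤ) ⁻¹' E)ᶜ : Set (ℤ → A × B)) :=
      MeasurableSet.iInter fun j => MeasurableSet.iInter fun _ => (measurable_shiftBy _ hE).compl
    convert hC.inter ((measurable_shiftBy (k : ℤ) hE).inter h1) using 1
    ext ω
    simp only [D, Set.mem_ofPred_eq, Set.mem_inter_iff, Set.mem_iInter, Set.mem_preimage,
      Set.mem_compl_iff]
  have hdisj : Pairwise (Function.onFun Disjoint D) := by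
    intro k l hkl
    refine Set.disjoint_left.2 fun ω hk hl => ?_
    rcases lt_or_gt_of_ne hkl with h | h
    · exact hl.2.2 k h hk.2.1
    · exact hk.2.2 l h hl.2.1
  -- With τ the first recurrence of z, an occurrence of y_1^n at distance k < τ in the past, seen
  -- from there, is an outcome in D k. These occurrences, k = 0 included, bound R_n.
  have hpt : ∀ᵐ ω ∂ν, ω ∈ E → (jointRecTime n ω : ℝ≥0∞) ≤
      ∑' k : ℕ, (D k).indicator 1 (shiftBy (-(k : ℤ)) ω) := by
    filter_upwards [ae_infinite_recurrence hν] with ω hω hωE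
    set q : ℕ → Prop := fun i => block ω (-(i : ℤ)) n = block ω 0 n
    set p : ℕ → Prop := fun i => block (sndPath ω) (-(i : ℤ)) n = block (sndPath ω) 0 n
    have hqp : ∀ i, q i → p i := fun i hi => by
      have hi' : block ω (-(i : ℤ)) n = block ω 0 n := hi
      simp only [p, block_sndPath, hi']
    have hz : block ω 0 n = z := hωE
    have hex : ∃ τ : ℕ, 0 < τ ∧ q τ := by
      obtain ⟨τ, hτ, h0⟩ := (hω n).exists_gt 0
      exact ⟨τ, h0, hτ⟩
    set τ := Nat.find hex
    obtain ⟨hτ0, hτq⟩ := Nat.find_spec hex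
    have hmin : ∀ i, 0 < i → i < τ → ¬q i := fun i h0 hi hq => Nat.find_min hex hi ⟨h0, hq⟩
    have hx : block (fstPath ω) (-(τ : ℤ)) n = block (fstPath ω) 0 n := by
      have hq' : block ω (-(τ : ℤ)) n = block ω 0 n := hτq
      simp only [block_fstPath, hq']
    have h1 : jointRecTime n ω ≤ (Nat.count p τ : ℕ∞) :=
      condRecTime_le_count ((hω n).mono fun i hi => hqp i hi) hτ0 hx (hqp τ hτq)
    have h2 : (jointRecTime n ω : ℝ≥0∞) ≤ (Nat.count p τ : ℝ≥0∞) := by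
      have := ENat.toENNReal_le.2 h1
      simpa using this
    refine h2.trans ?_
    refine le_trans ?_ (ENNReal.sum_le_tsum ((Finset.range τ).filter p))
    rw [Nat.count_eq_card_filter_range]
    rw [Finset.card_eq_sum_ones, Nat.cast_sum]
    refine Finset.sum_le_sum fun k hk => ?_
    obtain ⟨hkτ, hpk⟩ := Finset.mem_filter.1 hk
    rw [Finset.mem_range] at hkτ
    have hmem : shiftBy (-(k : ℤ)) ω ∈ D k := by
      refine ⟨?_, ?_, fun j hj hjE => ?_⟩
      · change block (sndPath (shiftBy (-(k : ℤ)) ω)) 0 n = _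
        rw [sndPath_shiftBy, block_shiftBy, zero_add]
        have hpk' : block (sndPath ω) (-(k : ℤ)) n = block (sndPath ω) 0 n := hpk
        rw [hpk', block_sndPath, hz]
      · rw [shiftBy_shiftBy]
        simpa using hωE
      · refine hmin (k - j) (by omega) (by omega) ?_
        have hjE' : block (shiftBy (j : ℤ) (shiftBy (-(k : ℤ)) ω)) 0 n = z := hjE
        rw [shiftBy_shiftBy, block_shiftBy, ← hz] at hjE'
        change block ω (-((k - j : ℕ) : ℤ)) n = _
        rw [← hjE']
        congr 1
        omega
    rw [Set.indicator_of_mem hmem]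
    simp
  calc ∫⁻ ω in E, (jointRecTime n ω : ℝ≥0∞) ∂ν
      ≤ ∫⁻ ω in E, ∑' k : ℕ, (D k).indicator 1 (shiftBy (-(k : ℤ)) ω) ∂ν :=
        setLIntegral_mono_ae' hE hpt
    _ ≤ ∫⁻ ω, ∑' k : ℕ, (D k).indicator 1 (shiftBy (-(k : ℤ)) ω) ∂ν :=
        setLIntegral_le_lintegral _ _
    _ = ∑' k : ℕ, ∫⁻ ω, (D k).indicator 1 (shiftBy (-(k : ℤ)) ω) ∂ν :=
        lintegral_tsum fun k =>
          ((measurable_one.indicator (hD k)).comp (measurable_shiftBy _)).aemeasurable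
    _ = ∑' k : ℕ, ν (D k) := by
        congr 1
        funext k
        rw [lintegral_shiftBy hν (-(k : ℤ)) (f := (D k).indicator 1)
          (measurable_one.indicator (hD k)), lintegral_indicator_one (hD k)]
    _ = ν (⋃ k, D k) := (measure_iUnion hdisj hD).symm
    _ ≤ ν C := measure_mono (Set.iUnion_subset fun k ω hω => hω.1)

lemma measurable_toENNReal_jointRecTime (n : ℕ) :
    Measurable fun ω : ℤ → A × B => (jointRecTime n ω : ℝ≥0∞) :=
  (Measurable.of_discrete (f := fun j : ℕ∞ => (j : ℝ≥0∞))).comp (measurable_jointRecTime n)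

/-- On a fixed word the conditional probability is constant, and the Kac inequality gives at most
P(y) · P(z)/P(y) ≤ P(z); summing over words gives 1. -/
lemma lintegral_jointRecTime_mul_le (hν : MeasurePreserving shift ν ν) (n : ℕ) :
    ∫⁻ ω, (jointRecTime n ω : ℝ≥0∞) * ENNReal.ofReal (condBlockProb ν n ω) ∂ν ≤ 1 := by
  rw [lintegral_eq_sum_block n]
  calc _ ≤ ∑ z : Fin n → A × B, ENNReal.ofReal (wordProb ν n z) := by
        refine Finset.sum_le_sum fun z _ => ?_
        have hE : MeasurableSet {ω : ℤ → A × B | block ω 0 n = z} :=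
          measurable_block 0 n (measurableSet_singleton z)
        set c : ℝ := wordProb (ν.map sndPath) n fun k => (z k).2
        have hc : 0 ≤ c := wordProb_nonneg _ _
        have h1 : ∫⁻ ω in {ω | block ω 0 n = z},
            (jointRecTime n ω : ℝ≥0∞) * ENNReal.ofReal (condBlockProb ν n ω) ∂ν
            = ∫⁻ ω in {ω | block ω 0 n = z},
              (jointRecTime n ω : ℝ≥0∞) * ENNReal.ofReal (wordProb ν n z / c) ∂ν := by
          refine setLIntegral_congr_fun hE fun ω hω => ?_
          have hω' : block ω 0 n = z := hω
          simp only [condBlockProb, blockProb, block_sndPath, hω', c]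
        rw [h1, lintegral_mul_const _ (measurable_toENNReal_jointRecTime n)]
        have h2 := setLIntegral_jointRecTime_le hν n z
        have h3 : ν {ω | block (sndPath ω) 0 n = fun k => (z k).2} = ENNReal.ofReal c := by
          rw [← ofReal_measureReal, ← wordProb_map_sndPath]
        rw [h3] at h2
        refine (mul_le_mul_left h2 _).trans ?_
        rw [← ENNReal.ofReal_mul hc]
        refine ENNReal.ofReal_le_ofReal ?_
        rcases eq_or_ne c 0 with h0 | h0
        · rw [h0, zero_mul]
          exact wordProb_nonneg _ _
        · rw [mul_div_cancel₀ _ h0]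
    _ = 1 := by
        rw [← ENNReal.ofReal_sum_of_nonneg fun z _ => wordProb_nonneg _ _, sum_wordProb,
          ENNReal.ofReal_one]

lemma ae_jointRecTime_ne_top (hν : Ergodic shift ν) :
    ∀ᵐ ω ∂ν, ∀ n, jointRecTime n ω ≠ ⊤ := by
  have h : ∀ᵐ ω ∂ν, ∀ n,
      (jointRecTime n ω : ℝ≥0∞) * ENNReal.ofReal (condBlockProb ν n ω) < ⊤ :=
    ae_all_iff.2 fun n => ae_lt_top ((measurable_toENNReal_jointRecTime n).mul
      (measurable_condBlockProb n).ennreal_ofReal)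
      (ne_top_of_le_ne_top ENNReal.one_ne_top
        (lintegral_jointRecTime_mul_le hν.toMeasurePreserving n))
  filter_upwards [h, condBlockProb_pos hν] with ω hω hpos n htop
  have := hω n
  rw [htop, ENat.toENNReal_top, ENNReal.top_mul (ENNReal.ofReal_pos.2 (hpos n)).ne'] at this
  exact lt_irrefl _ this

lemma toENNReal_eq_ofReal_toNat {j : ℕ∞} (hj : j ≠ ⊤) :
    (j : ℝ≥0∞) = ENNReal.ofReal (j.toNat : ℝ) := by
  obtain ⟨m, rfl⟩ := ENat.ne_top_iff_exists.1 hj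
  simp

lemma toNat_jointRecTime_pos {n : ℕ} {ω : ℤ → A × B} (h : jointRecTime n ω ≠ ⊤) :
    (0 : ℝ) < ((jointRecTime n ω).toNat : ℝ) := by
  have h1 : 1 ≤ jointRecTime n ω := one_le_condRecTime _ _ _
  obtain ⟨m, hm⟩ := ENat.ne_top_iff_exists.1 h
  rw [← hm] at h1 ⊢
  simpa [Nat.one_le_iff_ne_zero, Nat.pos_iff_ne_zero] using h1

/-- The upper bound on the conditional recurrence time. -/
lemma ae_eventually_log_recTime_mul_le (hν : Ergodic shift ν) :
    ∀ᵐ ω ∂ν, ∀ᶠ n : ℕ in atTop,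
      Real.log ((jointRecTime n ω).toNat * condBlockProb ν n ω) ≤ 3 * Real.log (n + 1) := by
  have h := ae_eventually_lt_of_lintegral_le (ν := ν) (C := 1)
    (F := fun n ω => (jointRecTime n ω : ℝ≥0∞) * ENNReal.ofReal (condBlockProb ν n ω))
    (fun n => ((measurable_toENNReal_jointRecTime n).mul
      (measurable_condBlockProb n).ennreal_ofReal).aemeasurable)
    (fun n => ?_)
  · filter_upwards [h, condBlockProb_pos hν, ae_jointRecTime_ne_top hν] with ω hω hpos hfin
    filter_upwards [hω] with n hn
    rw [toENNReal_eq_ofReal_toNat (hfin n), ← ENNReal.ofReal_mul (Nat.cast_nonneg _)] at hn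
    have h3 := (ENNReal.ofReal_lt_ofReal_iff (by positivity)).1 hn
    have := Real.log_le_log (mul_pos (toNat_jointRecTime_pos (hfin n)) (hpos n)) h3.le
    rwa [Real.log_pow] at this
  · refine (lintegral_jointRecTime_mul_le hν.toMeasurePreserving n).trans ?_
    rw [← ENNReal.ofReal_one]
    refine ENNReal.ofReal_le_ofReal ?_
    have : (0 : ℝ) ≤ n := n.cast_nonneg
    linarith

/-- With past and side information fixed, distinct x-words have distinct finite recurrence times,
and there are |A|^n words. -/
lemma sum_inv_jointRecTime_splice_le (ω : ℤ → A × B) (n : ℕ) (b : Fin n → B) :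
    ∑ a : Fin n → A, ((jointRecTime n (splice ω n fun k => (a k, b k)) : ℝ≥0∞))⁻¹ ≤
      ENNReal.ofReal (2 + n * Real.log (Fintype.card A)) := by
  refine (sum_inv_le_of_injective
    (fun a : Fin n → A => jointRecTime n (splice ω n fun k => (a k, b k)))
    (fun a => one_le_condRecTime _ _ _) fun a a' j h h' => ?_).trans_eq ?_
  · have hy : ∀ a : Fin n → A, sndPath (splice ω n fun k => (a k, b k)) =
        splice (sndPath ω) n b := fun a => sndPath_splice _ _ _
    have hx : ∀ a : Fin n → A, block (fstPath (splice ω n fun k => (a k, b k))) 0 n = a :=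
      fun a => by rw [block_fstPath, block_splice]
    simp only [jointRecTime, hy] at h h'
    rw [← hx a, ← hx a']
    refine block_eq_of_condRecTime_eq (fun k hk => ?_) h h'
    simp only [fstPath, splice_of_nonpos _ _ _ hk]
  · simp [Fintype.card_pi]

/-- For every past, the sum over x-words of 1/R_n is bounded uniformly in the y-word, and the
weights P(y_1^n) sum to 1. -/
lemma lintegral_inv_jointRecTime_mul_le (hν : MeasurePreserving shift ν ν) (n : ℕ) :
    ∫⁻ ω, ENNReal.ofReal (blockProb (ν.map sndPath) n (sndPath ω)) *
      ((jointRecTime n ω : ℝ≥0∞))⁻¹ * pastInv ν n ω ∂ν ≤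
      ENNReal.ofReal (2 + n * Real.log (Fintype.card A)) := by
  have : IsProbabilityMeasure (ν.map sndPath) :=
    Measure.isProbabilityMeasure_map measurable_sndPath.aemeasurable
  refine lintegral_mul_pastInv_le hν
    (W := fun ω => ENNReal.ofReal (blockProb (ν.map sndPath) n (sndPath ω)) *
      ((jointRecTime n ω : ℝ≥0∞))⁻¹) ?_ ?_ fun ω => ?_
  · exact ((measurable_blockProb n).comp measurable_sndPath).ennreal_ofReal.mul
      (measurable_toENNReal_jointRecTime n).inv
  · intro ω ω' h
    have hx : ∀ k : ℤ, k ≤ n → fstPath ω k = fstPath ω' k := fun k hk => by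
      simp only [fstPath, h k hk]
    have hy : ∀ k : ℤ, k ≤ n → sndPath ω k = sndPath ω' k := fun k hk => by
      simp only [sndPath, h k hk]
    have hb : block (sndPath ω) 0 n = block (sndPath ω') 0 n :=
      block_congr fun k _ hk => hy k (by omega)
    simp only [jointRecTime, condRecTime_congr hx hy, blockProb, hb]
  · rw [← (Equiv.arrowProdEquivProdArrow (Fin n) (fun _ => A) (fun _ => B)).symm.sum_comp,
      Fintype.sum_prod_type_right]
    have h1 : ∀ (b : Fin n → B) (a : Fin n → A),
        ENNReal.ofReal (blockProb (ν.map sndPath) n (sndPath (splice ω n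
          ((Equiv.arrowProdEquivProdArrow (Fin n) (fun _ => A) (fun _ => B)).symm (a, b))))) *
        ((jointRecTime n (splice ω n
          ((Equiv.arrowProdEquivProdArrow (Fin n) (fun _ => A) (fun _ => B)).symm
            (a, b))) : ℝ≥0∞))⁻¹
        = ENNReal.ofReal (wordProb (ν.map sndPath) n b) *
          ((jointRecTime n (splice ω n fun k => (a k, b k)) : ℝ≥0∞))⁻¹ := by
      intro b a
      congr 2
      rw [sndPath_splice, blockProb, block_splice]
      rfl
    simp only [h1]
    simp only [← Finset.mul_sum]
    refine (Finset.sum_le_sum fun b _ =>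
      mul_le_mul_right (sum_inv_jointRecTime_splice_le ω n b) _).trans ?_
    rw [← Finset.sum_mul, ← ENNReal.ofReal_sum_of_nonneg fun b _ => wordProb_nonneg _ _,
      sum_wordProb, ENNReal.ofReal_one, one_mul]

/-- The lower bound on the conditional recurrence time. -/
lemma ae_eventually_le_log_recTime_mul (hν : Ergodic shift ν) :
    ∀ᵐ ω ∂ν, ∀ᶠ n : ℕ in atTop,
      Real.log (blockProb ν n ω) - Real.log (pastBlockProb ν n ω) - 3 * Real.log (n + 1) ≤
        Real.log ((jointRecTime n ω).toNat * condBlockProb ν n ω) := by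
  have hmp := hν.toMeasurePreserving
  have hlogA : 0 ≤ Real.log (Fintype.card A) := Real.log_natCast_nonneg _
  have h := ae_eventually_lt_of_lintegral_le (ν := ν) (C := 2 + Real.log (Fintype.card A))
    (F := fun n ω => ENNReal.ofReal (blockProb (ν.map sndPath) n (sndPath ω)) *
      ((jointRecTime n ω : ℝ≥0∞))⁻¹ * pastInv ν n ω)
    (fun n => ((((measurable_blockProb n).comp measurable_sndPath).ennreal_ofReal.mul
      (measurable_toENNReal_jointRecTime n).inv).mul (measurable_pastInv n)).aemeasurable)
    (fun n => (lintegral_inv_jointRecTime_mul_le hmp n).trans (ENNReal.ofReal_le_ofReal ?_))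
  · filter_upwards [h, ae_blockProb_pos hmp, ae_blockProb_sndPath_pos hν,
      ae_jointRecTime_ne_top hν, pastBlockProb_pos hmp,
      ae_shiftBy hmp (ownProb_pos (ν := ν) (Set.Iic (-1)))] with ω hω hp hpy hfin hG hown
    filter_upwards [hω] with n hn
    have hR := toNat_jointRecTime_pos (hfin n)
    rw [toENNReal_eq_ofReal_toNat (hfin n), pastInv_eq hown, ← ENNReal.ofReal_inv_of_pos hR,
      ← ENNReal.ofReal_mul (hpy n).le,
      ← ENNReal.ofReal_mul (mul_nonneg (hpy n).le (inv_nonneg.2 hR.le))] at hn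
    have h3 := (ENNReal.ofReal_lt_ofReal_iff (by positivity)).1 hn
    have hpos1 := mul_pos (hpy n) (inv_pos.2 hR)
    have h4 := Real.log_le_log (mul_pos hpos1 (inv_pos.2 (hG n))) h3.le
    rw [Real.log_pow, Real.log_mul hpos1.ne' (inv_pos.2 (hG n)).ne',
      Real.log_mul (hpy n).ne' (inv_pos.2 hR).ne', Real.log_inv, Real.log_inv] at h4
    rw [condBlockProb, Real.log_mul hR.ne' (div_pos (hp n) (hpy n)).ne',
      Real.log_div (hp n).ne' (hpy n).ne']
    push_cast at h4
    linarith
  · have : (0 : ℝ) ≤ n := n.cast_nonneg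
    nlinarith

end Bounds

/-! ### Consequences of the summability of the coefficients `γ` -/

section Gamma

lemma measurable_logDist : Measurable fun p : ℝ × ℝ => logDist p.1 p.2 := by
  have hlog : Measurable fun t : ℝ => Real.logb 2 t := Real.measurable_log.div_const _
  refine Measurable.ite (measurableSet_eq_fun measurable_fst measurable_snd) measurable_const ?_
  refine Measurable.ite ?_ measurable_const ?_
  · exact (measurableSet_eq_fun measurable_fst measurable_const).union
      (measurableSet_eq_fun measurable_snd measurable_const)
  · exact ((hlog.comp measurable_fst).sub (hlog.comp measurable_snd)).norm.ennreal_ofReal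

lemma logDist_of_pos {p q : ℝ} (hp : 0 < p) (hq : 0 < q) :
    logDist p q = ENNReal.ofReal |Real.logb 2 p - Real.logb 2 q| := by
  rw [logDist]
  split_ifs with h1 h2
  · simp [h1]
  · exact absurd h2 (by simp [hp.ne', hq.ne'])
  · rfl

lemma log_sub_log_le_logDist {p q : ℝ} (hp : 0 < p) (hq : 0 < q) :
    Real.log p - Real.log q ≤ Real.log 2 * (logDist p q).toReal := by
  have h2 : 0 < Real.log 2 := Real.log_pos one_lt_two
  rw [logDist_of_pos hp hq, ENNReal.toReal_ofReal (abs_nonneg _), Real.logb, Real.logb]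
  rw [← sub_div, abs_div, abs_of_pos h2, mul_div_cancel₀ _ h2.ne']
  exact le_abs_self _

variable {A : Type*} [MeasurableSpace A]

lemma sigmaGen_eq_comap_path {Ω : Type*} (Z : ℤ → Ω → A) (S : Set ℤ) :
    sigmaGen Z S = (sigmaGen (coord A) S).comap (path Z) := by
  simp only [sigmaGen, MeasurableSpace.comap_iSup, MeasurableSpace.comap_comp]
  rfl

lemma measurable_path {Ω : Type*} [MeasurableSpace Ω] {Z : ℤ → Ω → A}
    (hZ : ∀ k, Measurable (Z k)) : Measurable (path Z) :=
  measurable_pi_lambda _ hZ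

variable [Fintype A] [MeasurableSingletonClass A]

/-- The coefficients `γ` depend only on the law of the process. -/
lemma gammaCoeff_map_path {Ω : Type*} [MeasurableSpace Ω] {μ : Measure Ω} [IsProbabilityMeasure μ]
    {Z : ℤ → Ω → A} (hZ : ∀ k, Measurable (Z k)) (d : ℕ) :
    gammaCoeff (μ.map (path Z)) (coord A) d = gammaCoeff μ Z d := by
  have hmp : MeasurePreserving (path Z) μ (μ.map (path Z)) :=
    (measurable_path hZ).measurePreserving μ
  have : IsProbabilityMeasure (μ.map (path Z)) :=
    Measure.isProbabilityMeasure_map (measurable_path hZ).aemeasurable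
  have hp : ∀ (S : Set ℤ) (a : A), μ⟦Z 0 ⁻¹' {a} | sigmaGen Z S⟧ =ᵐ[μ]
      (pastProb (μ.map (path Z)) S a) ∘ path Z := fun S a => by
    rw [sigmaGen_eq_comap_path]
    exact condProb_comp_measurePreserving hmp (sigmaGen_coord_le S) (measurableSet_coord_eq a)
  simp only [gammaCoeff]
  congr 1
  funext a
  have h1 := lintegral_map (μ := μ) (g := path Z)
    (f := fun x => logDist (pastProb (μ.map (path Z)) (Set.Iic (-1)) a x)
      (pastProb (μ.map (path Z)) (Set.Icc (-(d : ℤ)) (-1)) a x))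
    (measurable_logDist.comp ((measurable_pastProb _ a).prodMk (measurable_pastProb _ a)))
    (measurable_path hZ)
  refine h1.trans (lintegral_congr_ae ?_)
  filter_upwards [hp (Set.Iic (-1)) a, hp (Set.Icc (-(d : ℤ)) (-1)) a] with ω h2 h3
  rw [h2, h3]
  rfl

variable {ν : Measure (ℤ → A)} [IsProbabilityMeasure ν]

/-- γ maximises over fixed letters; splitting by the random letter x_0 costs a factor |A|. -/
lemma lintegral_logDist_stepProb_le (hν : MeasurePreserving shift ν ν) (d : ℕ) :
    ∫⁻ x, logDist (ownProb ν (Set.Iic (-1)) x) (stepProb ν d x) ∂ν ≤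
      Fintype.card A * gammaCoeff ν (coord A) d := by
  have h1 : ∫⁻ x, logDist (ownProb ν (Set.Iic (-1)) x) (stepProb ν d x) ∂ν =
      ∫⁻ x, logDist (ownProb ν (Set.Iic (-1)) x)
        (ownProb ν (Set.Icc (-(d : ℤ)) (-1)) x) ∂ν := by
    refine lintegral_congr_ae ?_
    filter_upwards [stepProb_ae_eq_ownProb hν d] with x hx
    rw [hx]
  rw [h1, lintegral_eq_sum_setLIntegral]
  refine (Finset.sum_le_card_nsmul _ _ (gammaCoeff ν (coord A) d) fun a _ => ?_).trans_eq
    (by simp)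
  have h2 : ∫⁻ x in coord A 0 ⁻¹' {a}, logDist (ownProb ν (Set.Iic (-1)) x)
        (ownProb ν (Set.Icc (-(d : ℤ)) (-1)) x) ∂ν =
      ∫⁻ x in coord A 0 ⁻¹' {a}, logDist (pastProb ν (Set.Iic (-1)) a x)
        (pastProb ν (Set.Icc (-(d : ℤ)) (-1)) a x) ∂ν := by
    refine setLIntegral_congr_fun (measurableSet_coord_eq a) fun x hx => ?_
    have hxa : x 0 = a := hx
    simp only [ownProb, hxa]
  rw [h2]
  exact (setLIntegral_le_lintegral _ _).trans
    (le_iSup (fun a => ∫⁻ x, logDist (pastProb ν (Set.Iic (-1)) a x)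
        (pastProb ν (Set.Icc (-(d : ℤ)) (-1)) a x) ∂ν) a)

/-- If the coefficients `γ` are summable, then `P(x_1^n | x_{-∞}^0)` exceeds `P(x_1^n)` at most by
a random factor that does not depend on `n`. -/
lemma ae_exists_log_pastBlockProb_sub_le (hν : MeasurePreserving shift ν ν)
    (hγ : ∑' d : ℕ, gammaCoeff ν (coord A) (d + 1) < ⊤) :
    ∀ᵐ x ∂ν, ∃ K : ℝ, ∀ n : ℕ,
      Real.log (pastBlockProb ν n x) - Real.log (blockProb ν n x) ≤ K := by
  set L : ℕ → (ℤ → A) → ℝ≥0∞ := fun i x =>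
    logDist (ownProb ν (Set.Iic (-1)) x) (stepProb ν i x)
  have hLm : ∀ i, Measurable (L i) := fun i =>
    measurable_logDist.comp ((measurable_ownProb' _).prodMk (measurable_stepProb i))
  have hLs : ∀ i : ℕ, Measurable fun x => L (i + 1) (shiftBy ((i + 1 : ℕ) + 1 : ℤ) x) :=
    fun i => (hLm (i + 1)).comp (measurable_shiftBy _)
  have hint : ∫⁻ x, ∑' i : ℕ, L (i + 1) (shiftBy ((i + 1 : ℕ) + 1 : ℤ) x) ∂ν ≠ ⊤ := by
    rw [lintegral_tsum fun i => (hLs i).aemeasurable]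
    refine ne_top_of_le_ne_top ?_ (ENNReal.tsum_le_tsum fun i => ?_)
      (b := ∑' i : ℕ, (Fintype.card A : ℝ≥0∞) * gammaCoeff ν (coord A) (i + 1))
    · rw [ENNReal.tsum_mul_left]
      exact ENNReal.mul_ne_top (ENNReal.natCast_ne_top _) hγ.ne
    · rw [lintegral_shiftBy hν _ (hLm (i + 1))]
      exact lintegral_logDist_stepProb_le hν (i + 1)
  have hfin := ae_lt_top (Measurable.tsum hLs) hint
  filter_upwards [hfin, ae_wordProb_pos hν,
    ae_shiftBy hν (ownProb_pos (ν := ν) (Set.Iic (-1)))] with x hx hpos hown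
  have hstep : ∀ i : ℕ, 0 < stepProb ν i (shiftBy (i + 1) x) := fun i => by
    have := stepProb_eq_div (ν := ν) x i 0
    rw [show (i : ℤ) + 1 = 0 + 1 + i by ring, this]
    exact div_pos (hpos _ _) (hpos _ _)
  -- The summability hypothesis starts at d = 1. The term i = 0 is finite pointwise, because both
  -- probabilities are positive.
  have hT : ∑' i : ℕ, L i (shiftBy (i + 1) x) ≠ ⊤ := by
    rw [tsum_eq_zero_add' ENNReal.summable]
    refine ENNReal.add_ne_top.2 ⟨?_, hx.ne⟩
    simp only [L]
    rw [logDist_of_pos (hown _) (hstep 0)]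
    exact ENNReal.ofReal_ne_top
  refine ⟨Real.log 2 * (∑' i : ℕ, L i (shiftBy (i + 1) x)).toReal, fun n => ?_⟩
  rw [blockProb_eq_prod (fun n => hpos 0 n) n, pastBlockProb,
    Real.log_prod fun i _ => (hown _).ne', Real.log_prod fun i _ => (hstep i).ne',
    ← Finset.sum_sub_distrib]
  have h1 : ∑ i ∈ Finset.range n, (Real.log (ownProb ν (Set.Iic (-1)) (shiftBy (i + 1) x)) -
      Real.log (stepProb ν i (shiftBy (i + 1) x))) ≤
      ∑ i ∈ Finset.range n, Real.log 2 * (L i (shiftBy (i + 1) x)).toReal :=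
    Finset.sum_le_sum fun i _ => log_sub_log_le_logDist (hown _) (hstep i)
  refine h1.trans ?_
  rw [← Finset.mul_sum, ← ENNReal.toReal_sum fun i _ => ENNReal.ne_top_of_tsum_ne_top hT i]
  exact mul_le_mul_of_nonneg_left (ENNReal.toReal_mono hT (ENNReal.sum_le_tsum _))
    (Real.log_nonneg one_le_two)

end Gamma

/-! ### The conditional entropy rate -/

section CondEntropy

variable {A B : Type*} [MeasurableSpace A] [MeasurableSpace B]
  [Fintype A] [MeasurableSingletonClass A] [Fintype B] [MeasurableSingletonClass B]

lemma measurable_pair {Ω : Type*} [MeasurableSpace Ω] {X : ℤ → Ω → A} {Y : ℤ → Ω → B}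
    (hX : ∀ k, Measurable (X k)) (hY : ∀ k, Measurable (Y k)) (k : ℤ) :
    Measurable (pair X Y k) :=
  (hX k).prodMk (hY k)

lemma sum_wordProb_prodMk {ν : Measure (ℤ → A × B)} [IsProbabilityMeasure ν] (n : ℕ)
    (b : Fin n → B) :
    ∑ a : Fin n → A, wordProb ν n (fun k => (a k, b k)) = wordProb (ν.map sndPath) n b := by
  have hf : Measurable fun ω : ℤ → A × B => block (fstPath ω) 0 n :=
    (measurable_block 0 n).comp measurable_fstPath
  have h := sum_measureReal_preimage_singleton (μ := ν.restrict {ω | block (sndPath ω) 0 n = b})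
    (f := fun ω : ℤ → A × B => block (fstPath ω) 0 n)
    Finset.univ (fun a _ => hf (measurableSet_singleton a))
  rw [Finset.coe_univ, Set.preimage_univ, measureReal_restrict_apply_univ] at h
  rw [wordProb_map_sndPath, ← h]
  refine Finset.sum_congr rfl fun a _ => ?_
  rw [measureReal_restrict_apply (hf (measurableSet_singleton a)), wordProb]
  congr 1
  ext ω
  simp only [Set.mem_ofPred_eq, Set.mem_inter_iff, Set.mem_preimage, Set.mem_singleton_iff,
    block_fstPath, block_sndPath, funext_iff, Prod.ext_iff, forall_and]

variable {Ω : Type*} [MeasurableSpace Ω] {μ : Measure Ω} [IsProbabilityMeasure μ]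
  {X : ℤ → Ω → A} {Y : ℤ → Ω → B}

lemma measureReal_block_pair (hX : ∀ k, Measurable (X k)) (hY : ∀ k, Measurable (Y k)) (n : ℕ)
    (x : Fin n → A) (y : Fin n → B) :
    μ.real {ω | block (path X ω) 0 n = x ∧ block (path Y ω) 0 n = y} =
      wordProb (μ.map (path (pair X Y))) n fun k => (x k, y k) := by
  rw [wordProb, map_measureReal_apply (measurable_path (measurable_pair hX hY))
    (s := {z | block z 0 n = fun k => (x k, y k)})
    (measurable_block 0 n (measurableSet_singleton _))]
  congr 1
  ext ω
  simp only [Set.mem_ofPred_eq, Set.mem_preimage, funext_iff, block, path, pair, Prod.ext_iff,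
    forall_and]

lemma measureReal_block_snd (hX : ∀ k, Measurable (X k)) (hY : ∀ k, Measurable (Y k)) (n : ℕ)
    (y : Fin n → B) :
    μ.real {ω | block (path Y ω) 0 n = y} =
      wordProb ((μ.map (path (pair X Y))).map sndPath) n y := by
  have : IsProbabilityMeasure (μ.map (path (pair X Y))) :=
    Measure.isProbabilityMeasure_map (measurable_path (measurable_pair hX hY)).aemeasurable
  rw [wordProb_map_sndPath, map_measureReal_apply (measurable_path (measurable_pair hX hY))
    (s := {z | block (sndPath z) 0 n = y})
    (((measurable_block 0 n).comp measurable_sndPath) (measurableSet_singleton _))]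
  rfl

lemma condProbRV_eq (hX : ∀ k, Measurable (X k)) (hY : ∀ k, Measurable (Y k)) (n : ℕ) (ω : Ω) :
    condProbRV μ X Y n ω = condBlockProb (μ.map (path (pair X Y))) n (path (pair X Y) ω) := by
  rw [condProbRV, condPMF, measureReal_block_pair hX hY, measureReal_block_snd hX hY]
  rfl

/-- The chain rule H(X|Y) = H(X,Y) - H(Y); division by log 2 converts nats to bits. -/
lemma condEntropy_eq (hX : ∀ k, Measurable (X k)) (hY : ∀ k, Measurable (Y k)) (n : ℕ) :
    condEntropy μ X Y n = (blockEntropy (μ.map (path (pair X Y))) n -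
      blockEntropy ((μ.map (path (pair X Y))).map sndPath) n) / Real.log 2 := by
  set ν := μ.map (path (pair X Y))
  have : IsProbabilityMeasure ν :=
    Measure.isProbabilityMeasure_map (measurable_path (measurable_pair hX hY)).aemeasurable
  have hterm : ∀ (x : Fin n → A) (y : Fin n → B),
      wordProb ν n (fun k => (x k, y k)) * Real.logb 2
        (wordProb ν n (fun k => (x k, y k)) / wordProb (ν.map sndPath) n y) =
      (-Real.negMulLog (wordProb ν n fun k => (x k, y k)) -
        wordProb ν n (fun k => (x k, y k)) * Real.log (wordProb (ν.map sndPath) n y)) /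
          Real.log 2 := by
    intro x y
    have hle : wordProb ν n (fun k => (x k, y k)) ≤ wordProb (ν.map sndPath) n y := by
      rw [← sum_wordProb_prodMk]
      exact Finset.single_le_sum (f := fun a : Fin n → A => wordProb ν n fun k => (a k, y k))
        (fun _ _ => wordProb_nonneg _ _) (Finset.mem_univ x)
    rcases (wordProb_nonneg (ν := ν) n fun k => (x k, y k)).eq_or_lt with h0 | h0
    · simp [← h0]
    · rw [Real.logb, Real.log_div h0.ne' (h0.trans_le hle).ne', Real.negMulLog]
      ring
  simp only [condEntropy, condPMF, measureReal_block_pair hX hY, measureReal_block_snd hX hY]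
  change -∑ x : Fin n → A, ∑ y : Fin n → B, wordProb ν n (fun k => (x k, y k)) * Real.logb 2
        (wordProb ν n (fun k => (x k, y k)) / wordProb (ν.map sndPath) n y) = _
  simp only [hterm, ← Finset.sum_div, Finset.sum_sub_distrib, Finset.sum_neg_distrib]
  have h1 : ∑ x : Fin n → A, ∑ y : Fin n → B,
      Real.negMulLog (wordProb ν n fun k => (x k, y k)) = blockEntropy ν n := by
    rw [blockEntropy,
      ← (Equiv.arrowProdEquivProdArrow (Fin n) (fun _ => A) (fun _ => B)).symm.sum_comp,
      Fintype.sum_prod_type]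
    rfl
  have h2 : ∑ x : Fin n → A, ∑ y : Fin n → B,
      wordProb ν n (fun k => (x k, y k)) * Real.log (wordProb (ν.map sndPath) n y) =
      -blockEntropy (ν.map sndPath) n := by
    rw [Finset.sum_comm, blockEntropy, ← Finset.sum_neg_distrib]
    refine Finset.sum_congr rfl fun y _ => ?_
    rw [← Finset.sum_mul, sum_wordProb_prodMk, Real.negMulLog]
    ring
  rw [h1, h2, ← neg_div]
  congr 1
  ring

lemma condEntropyRate_eq (hX : ∀ k, Measurable (X k)) (hY : ∀ k, Measurable (Y k))
    (hXY : IsStationaryErgodic μ (pair X Y)) :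
    condEntropyRate μ X Y = (entropyRate (μ.map (path (pair X Y))) -
      entropyRate ((μ.map (path (pair X Y))).map sndPath)) / Real.log 2 := by
  have : IsProbabilityMeasure (μ.map (path (pair X Y))) :=
    Measure.isProbabilityMeasure_map (measurable_path (measurable_pair hX hY)).aemeasurable
  have : IsProbabilityMeasure ((μ.map (path (pair X Y))).map sndPath) :=
    Measure.isProbabilityMeasure_map measurable_sndPath.aemeasurable
  have h1 := tendsto_blockEntropy_div (Ergodic.toMeasurePreserving hXY)
  have h2 := tendsto_blockEntropy_div (ergodic_map_sndPath hXY).toMeasurePreserving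
  refine Tendsto.limsup_eq (((h1.sub h2).div_const (Real.log 2)).congr fun n => ?_)
  rw [condEntropy_eq hX hY]
  ring

end CondEntropy

/-! ### Asymptotics of the conditional recurrence time -/

section Asymptotic

lemma isLittleO_log_succ_rpow {β : ℝ} (hβ : 0 < β) :
    (fun n : ℕ => Real.log (n + 1)) =o[atTop] fun n : ℕ => (n : ℝ) ^ β := by
  have h := (isLittleO_log_rpow_atTop hβ).comp_tendsto
    ((tendsto_atTop_add_const_right atTop (1 : ℝ) tendsto_natCast_atTop_atTop) :
      Tendsto (fun n : ℕ => (n : ℝ) + 1) atTop atTop)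
  refine h.trans_isBigO (IsBigO.of_bound ((2 : ℝ) ^ β) ?_)
  filter_upwards [eventually_ge_atTop 1] with n hn
  have hn' : (1 : ℝ) ≤ n := by exact_mod_cast hn
  simp only [Function.comp]
  rw [Real.norm_of_nonneg (by positivity), Real.norm_of_nonneg (by positivity),
    ← Real.mul_rpow zero_le_two (by linarith)]
  exact Real.rpow_le_rpow (by linarith) (by linarith) hβ.le

variable {A B : Type*} [MeasurableSpace A] [MeasurableSpace B]
  [Fintype A] [MeasurableSingletonClass A] [Fintype B] [MeasurableSingletonClass B]
  {ν : Measure (ℤ → A × B)} [IsProbabilityMeasure ν]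

lemma ae_isLittleO_log_recTime_mul_rpow (hν : Ergodic shift ν)
    (hγ : ∑' d : ℕ, gammaCoeff ν (coord (A × B)) (d + 1) < ⊤) :
    ∀ᵐ ω ∂ν, ∀ β : ℝ, 0 < β →
      (fun n : ℕ => Real.log ((jointRecTime n ω).toNat * condBlockProb ν n ω)) =o[atTop]
        fun n : ℕ => (n : ℝ) ^ β := by
  filter_upwards [ae_eventually_log_recTime_mul_le hν, ae_eventually_le_log_recTime_mul hν,
    ae_exists_log_pastBlockProb_sub_le hν.toMeasurePreserving hγ] with ω hup hlow ⟨K, hK⟩ β hβ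
  have h1 : (fun _ : ℕ => |K|) =o[atTop] fun n : ℕ => (n : ℝ) ^ β := by
    refine isLittleO_const_left.2 (Or.inr ?_)
    exact tendsto_norm_atTop_atTop.comp
      ((tendsto_rpow_atTop hβ).comp tendsto_natCast_atTop_atTop)
  refine IsBigO.trans_isLittleO (IsBigO.of_bound 1 ?_)
    (h1.add ((isLittleO_log_succ_rpow hβ).const_mul_left 3))
  filter_upwards [hup, hlow] with n h2 h3
  have hlog : 0 ≤ Real.log ((n : ℝ) + 1) := Real.log_nonneg (by simp)
  rw [one_mul, Real.norm_eq_abs, Real.norm_of_nonneg (by positivity), abs_le]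
  have := hK n
  have := le_abs_self K
  have := abs_nonneg K
  constructor <;> linarith

lemma ae_isLittleO_log_recTime_mul (hν : Ergodic shift ν) :
    ∀ᵐ ω ∂ν,
      (fun n : ℕ => Real.log ((jointRecTime n ω).toNat * condBlockProb ν n ω)) =o[atTop]
        fun n : ℕ => (n : ℝ) := by
  have hgap := ae_all_iff.2 fun m : ℕ => ae_eventually_log_pastBlockProb_sub_le hν
    (show (0 : ℝ) < 1 / (m + 1) by positivity)
  filter_upwards [ae_eventually_log_recTime_mul_le hν, ae_eventually_le_log_recTime_mul hν,
    hgap] with ω hup hlow hω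
  refine isLittleO_iff.2 fun c hc => ?_
  obtain ⟨m, hm⟩ := exists_nat_one_div_lt hc
  filter_upwards [hup, hlow, hω m, eventually_linear_add_log_le hc 0] with n h1 h2 h3 h4
  have hn : (0 : ℝ) ≤ n := n.cast_nonneg
  have h5 := mul_le_mul_of_nonneg_right hm.le hn
  rw [Real.norm_of_nonneg hn, Real.norm_eq_abs, abs_le]
  constructor <;> linarith

/-- R_n is the product of R_n P(x_1^n | y_1^n) and P(y_1^n)/P(z_1^n); the first factor is
subexponential and Shannon–McMillan–Breiman handles the second. -/
lemma ae_tendsto_log_recTime_div (hν : Ergodic shift ν) :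
    ∀ᵐ ω ∂ν, Tendsto (fun n : ℕ => Real.log (jointRecTime n ω).toNat / n) atTop
      (𝓝 (entropyRate ν - entropyRate (ν.map sndPath))) := by
  have : IsProbabilityMeasure (ν.map sndPath) :=
    Measure.isProbabilityMeasure_map measurable_sndPath.aemeasurable
  filter_upwards [ae_isLittleO_log_recTime_mul hν, tendsto_neg_log_blockProb_div hν,
    ae_of_ae_map measurable_sndPath.aemeasurable
      (tendsto_neg_log_blockProb_div (ergodic_map_sndPath hν)),
    ae_blockProb_pos hν.toMeasurePreserving, ae_blockProb_sndPath_pos hν,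
    ae_jointRecTime_ne_top hν] with ω h1 h2 h3 hp hpy hfin
  have h4 := (h1.tendsto_div_nhds_zero.add h2).sub h3
  rw [zero_add] at h4
  refine h4.congr fun n => ?_
  have hR := toNat_jointRecTime_pos (hfin n)
  rw [condBlockProb, Real.log_mul hR.ne' (div_pos (hp n) (hpy n)).ne',
    Real.log_div (hp n).ne' (hpy n).ne']
  ring

end Asymptotic

end SideInfo

/-! ### Transfer from path space to the given processes -/

theorem mainTheorem9 {Ω 𝒳 𝒴 : Type*} [MeasurableSpace Ω]
    [Fintype 𝒳] [MeasurableSpace 𝒳] [MeasurableSingletonClass 𝒳]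
    [Fintype 𝒴] [MeasurableSpace 𝒴] [MeasurableSingletonClass 𝒴]
    (μ : Measure Ω) [IsProbabilityMeasure μ]
    (X : ℤ → Ω → 𝒳) (Y : ℤ → Ω → 𝒴)
    (hX : ∀ k, Measurable (X k)) (hY : ∀ k, Measurable (Y k))
    (hXY : SideInfo.IsStationaryErgodic μ (SideInfo.pair X Y)) :
    -- the quantities below are well defined: almost surely, for all `n`,
    -- `R_n(X|Y)` is finite and at least one, and `P(X_1^n|Y_1^n) > 0`
    (∀ᵐ ω ∂μ, ∀ n : ℕ,
      SideInfo.condRecTime (SideInfo.path X ω) (SideInfo.path Y ω) n ≠ ⊤ ∧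
      1 ≤ SideInfo.condRecTime (SideInfo.path X ω) (SideInfo.path Y ω) n ∧
      0 < SideInfo.condProbRV μ X Y n ω) ∧
    -- (a)
    ((∑' d : ℕ, SideInfo.gammaCoeff μ (SideInfo.pair X Y) (d + 1) < ⊤) →
      (∑' d : ℕ, SideInfo.gammaCoeff μ Y (d + 1) < ⊤) →
      ∀ β : ℝ, 0 < β → ∀ᵐ ω ∂μ,
        (fun n : ℕ => Real.logb 2
          (((SideInfo.condRecTime (SideInfo.path X ω) (SideInfo.path Y ω) n).toNat : ℝ) *
            SideInfo.condProbRV μ X Y n ω)) =o[atTop] (fun n : ℕ => (n : ℝ) ^ β)) ∧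
    -- (b)
    (∀ᵐ ω ∂μ,
      (fun n : ℕ => Real.logb 2
        (((SideInfo.condRecTime (SideInfo.path X ω) (SideInfo.path Y ω) n).toNat : ℝ) *
          SideInfo.condProbRV μ X Y n ω)) =o[atTop] (fun n : ℕ => (n : ℝ))) ∧
    -- consequence of (b)
    (∀ᵐ ω ∂μ, Tendsto
      (fun n : ℕ => (1 / (n : ℝ)) * Real.logb 2
        ((SideInfo.condRecTime (SideInfo.path X ω) (SideInfo.path Y ω) n).toNat : ℝ))
      atTop (𝓝 (SideInfo.condEntropyRate μ X Y))) := by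
  have hm := SideInfo.measurable_path (SideInfo.measurable_pair hX hY)
  have : IsProbabilityMeasure (μ.map (SideInfo.path (SideInfo.pair X Y))) :=
    Measure.isProbabilityMeasure_map hm.aemeasurable
  have hν : Ergodic SideInfo.shift (μ.map (SideInfo.path (SideInfo.pair X Y))) := hXY
  simp only [SideInfo.condProbRV_eq hX hY]
  refine ⟨?_, fun hγ _ β hβ => ?_, ?_, ?_⟩
  · filter_upwards [ae_of_ae_map hm.aemeasurable (SideInfo.ae_jointRecTime_ne_top hν),
      ae_of_ae_map hm.aemeasurable (SideInfo.condBlockProb_pos hν)] with ω h1 h2 n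
    exact ⟨h1 n, SideInfo.one_le_condRecTime _ _ _, h2 n⟩
  · simp only [← SideInfo.gammaCoeff_map_path (SideInfo.measurable_pair hX hY)] at hγ
    filter_upwards [ae_of_ae_map hm.aemeasurable
      (SideInfo.ae_isLittleO_log_recTime_mul_rpow hν hγ)] with ω h
    simp only [Real.logb, div_eq_inv_mul]
    exact (h β hβ).const_mul_left _
  · filter_upwards [ae_of_ae_map hm.aemeasurable
      (SideInfo.ae_isLittleO_log_recTime_mul hν)] with ω h
    simp only [Real.logb, div_eq_inv_mul]
    exact h.const_mul_left _
  · rw [SideInfo.condEntropyRate_eq hX hY hXY]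
    filter_upwards [ae_of_ae_map hm.aemeasurable
      (SideInfo.ae_tendsto_log_recTime_div hν)] with ω h
    refine (h.div_const (Real.log 2)).congr fun n => ?_
    rw [Real.logb, div_div, mul_comm (n : ℝ), ← div_div, one_div, div_eq_inv_mul]
    rfl
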